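/- Let $M$ be a closed (compact, boundaryless) smooth manifold of dimension $d$ with a smooth Riemannian metric, and let $\mu$ be a Borel probability measure on $\mathrm{Diff}^\infty_{\mathrm{vol}}(M)$, the smooth diffeomorphisms of $M$ that preserve the Riemannian volume. Assume that $\mu$ has bounded support; it is enough that for some constant $C_0$ one has $\|D_xf(v)\|\le C_0\|v\|$ for $\mu$-a.e. $f$, all $x\in M$ and all $v\in T_xM$. For $1\le k\le d-1$, equip $\bigwedge^k T_xM$ with the norm induced by the metric (so $\|v_1\wedge\dots\wedge v_k\|^2=\det(\langle v_i,v_j\rangle)_{i,j}$) and let $D_xf$ act on it by $D_xf(v_1\wedge\dots\wedge v_k)=D_xfv_1\wedge\dots\wedge D_xfv_k$. Let $\mu^{(N)}$ be the $N$-fold convolution power of $\mu$. Call $\mu$ *uniformly expanding in dimension $k$* if there are $C>0$ and $N\in\mathbb N$ such that $\int\log\|D_xf(v)\|\,d\mu^{(N)}(f)>C$ for all $x\in M$ and all decomposable $v\in\bigwedge^kT_xM$ with $\|v\|=1$; call $\mu$ *uniformly expanding in all dimensions* if this holds for every $k\in\{1,\dots,d-1\}$. Let $\mathbf{Gr}^k(TM)$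 be the bundle of $k$-dimensional subspaces of the tangent spaces, on which $f$ acts by $F_f(x,V)=(f(x),D_xf(V))$. A Borel probability measure $\eta$ on it is *$\mu$-stationary* if $\mu*\eta=\eta$, and a stationary $\eta$ is *ergodic* if every Borel set $A$ with $\eta(F_f^{-1}(A)\,\triangle\,A)=0$ for $\mu$-a.e. $f$ satisfies $\eta(A)\in\{0,1\}$. **Theorem.** Suppose that $\mu$ is not uniformly expanding in all dimensions. Then for some $k\in\{1,\dots,d-1\}$ there is an ergodic $\mu$-stationary Borel probability measure $\eta$ on $\mathbf{Gr}^k(TM)$ whose Lyapunov exponent on $\mathbb P(\bigwedge^kTM)$ is non-positive: there is a constant $\chi\le 0$ such that for $\mu^{\mathbb N}\times\eta$-a.e. $(\alpha,(x,V))$, $\alpha=(f_0,f_1,\dots)$, and every $v=v_1\wedge\dots\wedge v_k$ with $v_1,\dots,v_k$ a basis of $V$, $$\lim_{n\to\infty}\frac1n\log\|D_x(f_{n-1}\circ\dots\circ f_0)(v)\|=\chi .$$ -/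

import Mathlib

open Manifold Bundle MeasureTheory Filter Topology
open scoped ContDiff

namespace RandomWalk

noncomputable section

/-- `Diff^∞(M)`: the smooth diffeomorphisms of the `d`-dimensional manifold `M`. -/
abbrev Diff (d : ℕ) (M : Type*) [TopologicalSpace M] [ChartedSpace (EuclideanSpace ℝ (Fin d)) M] :
    Type _ :=
  Diffeomorph (𝓡 d) (𝓡 d) M M ∞

/-- The σ-algebra on `Diff^∞(M)` generated by the evaluations `f ↦ f x`. For compact `M` it is the
Borel σ-algebra of the (Polish) `C^∞` topology, since countably many evaluations separate points. -/
instance instMeasurableSpaceDiff (d : ℕ) (M : Type*) [TopologicalSpace M]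
    [ChartedSpace (EuclideanSpace ℝ (Fin d)) M] [MeasurableSpace M] : MeasurableSpace (Diff d M) :=
  ⨆ x : M, MeasurableSpace.comap (fun f : Diff d M => f x) inferInstance

instance instFiniteDimensionalTangentSpace {d : ℕ} {M : Type*} [TopologicalSpace M]
    [ChartedSpace (EuclideanSpace ℝ (Fin d)) M] (x : M) :
    FiniteDimensional ℝ (TangentSpace (𝓡 d) x) :=
  inferInstanceAs (FiniteDimensional ℝ (EuclideanSpace ℝ (Fin d)))

section Grassmann

variable (d k : ℕ) (M : Type*) [TopologicalSpace M] [ChartedSpace (EuclideanSpace ℝ (Fin d)) M]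

/-- The bundle of `k`-frames of `TM`: a point of `M` with `k` linearly independent tangent vectors
at that point. -/
structure TangentFrame where
  base : M
  vec : Fin k → TangentSpace (𝓡 d) base
  linearIndependent : LinearIndependent ℝ vec

/-- The topology of the frame bundle, as a subspace of `M × (TM)^k`. -/
instance instTopologicalSpaceTangentFrame [IsManifold (𝓡 d) ∞ M] :
    TopologicalSpace (TangentFrame d k M) :=
  TopologicalSpace.induced
    (fun e => ((e.base, fun i => ⟨e.base, e.vec i⟩) : M × (Fin k → TangentBundle (𝓡 d) M)))
    inferInstance

/-- The Grassmann bundle `Gr^k(TM)`: a point of `M` with a `k`-dimensional subspace of the tangent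
space at that point. -/
structure GrassmannBundle where
  base : M
  plane : Submodule ℝ (TangentSpace (𝓡 d) base)
  finrank_plane : Module.finrank ℝ plane = k

variable {d k M}

/-- The `k`-plane spanned by a `k`-frame. -/
def TangentFrame.toGrassmann (e : TangentFrame d k M) : GrassmannBundle d k M where
  base := e.base
  plane := Submodule.span ℝ (Set.range e.vec)
  finrank_plane := by
    rw [finrank_span_eq_card e.linearIndependent, Fintype.card_fin]

/-- The topology of `Gr^k(TM)`: the quotient topology from the bundle of `k`-frames. -/
instance instTopologicalSpaceGrassmannBundle [IsManifold (𝓡 d) ∞ M] :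
    TopologicalSpace (GrassmannBundle d k M) :=
  TopologicalSpace.coinduced TangentFrame.toGrassmann inferInstance

/-- `Gr^k(TM)` carries its Borel σ-algebra. -/
instance instMeasurableSpaceGrassmannBundle [IsManifold (𝓡 d) ∞ M] :
    MeasurableSpace (GrassmannBundle d k M) :=
  borel _

/-- The action of a diffeomorphism on the Grassmann bundle, `(x, V) ↦ (f x, D_x f V)`. -/
def grassmannMap [IsManifold (𝓡 d) ∞ M] (f : Diff d M) (ξ : GrassmannBundle d k M) :
    GrassmannBundle d k M where
  base := f ξ.base
  plane := ξ.plane.map (mfderiv (𝓡 d) (𝓡 d) f ξ.base).toLinearMap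
  finrank_plane := by
    exact (LinearEquiv.finrank_map_eq
      (f.mfderivToContinuousLinearEquiv (x := ξ.base) (by simp)).toLinearEquiv ξ.plane).trans
        ξ.finrank_plane

/-- The element `w` of `⋀^k T_x M` represents the point `(x, V)` of `Gr^k(TM)` under the Plücker
embedding: `w = v₁ ∧ ⋯ ∧ v_k` for a basis `v₁, …, v_k` of `V`. -/
def PluckerRepresents (ξ : GrassmannBundle d k M) (w : ⋀[ℝ]^k (TangentSpace (𝓡 d) ξ.base)) :
    Prop :=
  ∃ v : Fin k → TangentSpace (𝓡 d) ξ.base, LinearIndependent ℝ v ∧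
    Submodule.span ℝ (Set.range v) = ξ.plane ∧ w = exteriorPower.ιMulti ℝ k v

/-- The derivative on exterior powers, `D_x f (v₁ ∧ ⋯ ∧ v_k) = D_x f v₁ ∧ ⋯ ∧ D_x f v_k`. -/
def extPowDeriv (k : ℕ) (f : Diff d M) (x : M) :
    ⋀[ℝ]^k (TangentSpace (𝓡 d) x) →ₗ[ℝ] ⋀[ℝ]^k (TangentSpace (𝓡 d) (f x)) :=
  exteriorPower.map k (mfderiv (𝓡 d) (𝓡 d) f x).toLinearMap

end Grassmann

section Walk

variable {d : ℕ} {M : Type*} [TopologicalSpace M] [ChartedSpace (EuclideanSpace ℝ (Fin d)) M]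

/-- The `n`-fold convolution power `μ^{(n)} = μ ∗ ⋯ ∗ μ` on the group `Diff^∞(M)`: the law of
`f_{n-1} ∘ ⋯ ∘ f_0` for independent `f_i` of law `μ`. -/
def convPow [MeasurableSpace M] (μ : Measure (Diff d M)) : ℕ → Measure (Diff d M)
  | 0 => Measure.dirac (Diffeomorph.refl (𝓡 d) M ∞)
  | n + 1 => (μ.prod (convPow μ n)).map (fun p => p.2.trans p.1)

/-- The random composition `f^n_α = f_{n-1} ∘ ⋯ ∘ f_0`, where `α = (f_0, f_1, …)`. -/
def iterate (α : ℕ → Diff d M) : ℕ → Diff d M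
  | 0 => Diffeomorph.refl (𝓡 d) M ∞
  | n + 1 => (iterate α n).trans (α n)

variable [IsManifold (𝓡 d) ∞ M] [MeasurableSpace M]

/-- `η` is `μ`-stationary: `μ ∗ η = η`. -/
def IsStationary {k : ℕ} (μ : Measure (Diff d M)) (η : Measure (GrassmannBundle d k M)) : Prop :=
  (μ.prod η).map (fun p => grassmannMap p.1 p.2) = η

/-- Ergodicity of a stationary probability measure: a measurable set which is invariant modulo
`η` under `μ`-almost every diffeomorphism has measure `0` or `1`. -/
def IsErgodic {k : ℕ} (μ : Measure (Diff d M)) (η : Measure (GrassmannBundle d k M)) : Prop :=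
  ∀ A : Set (GrassmannBundle d k M), MeasurableSet A →
    (∀ᵐ f : Diff d M ∂μ, η (symmDiff (grassmannMap f ⁻¹' A) A) = 0) → η A = 0 ∨ η A = 1

end Walk

section Riemannian

variable {d : ℕ} {M : Type*} [TopologicalSpace M] [ChartedSpace (EuclideanSpace ℝ (Fin d)) M]
  [IsManifold (𝓡 d) ∞ M] [RiemannianBundle (fun x : M => TangentSpace (𝓡 d) x)]

/-- `f` preserves the Riemannian volume. On the line `⋀^d T_x M` the Riemannian volume density is
the norm `‖v₁ ∧ ⋯ ∧ v_d‖`, the volume of the parallelotope spanned by `v₁, …, v_d`. -/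
def IsVolumePreserving (f : Diff d M) : Prop :=
  ∀ (x : M) (w : ⋀[ℝ]^d (TangentSpace (𝓡 d) x)), ‖extPowDeriv d f x w‖ = ‖w‖

variable [MeasurableSpace M]

/-- The support of `μ` is bounded (in the `C^1` sense). -/
def HasBoundedSupport (μ : Measure (Diff d M)) : Prop :=
  ∃ C : ℝ, ∀ᵐ f : Diff d M ∂μ, ∀ (x : M) (v : TangentSpace (𝓡 d) x),
    ‖mfderiv (𝓡 d) (𝓡 d) f x v‖ ≤ C * ‖v‖

/-- Uniform expansion in dimension `k`. The points of `ℙ(⋀^k T_x M)` are represented by unit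
vectors, and the norm of `⋀^k T_x M` is given by Gram determinants. (A Bochner integral that
exceeds a positive number is that of an integrable function.) -/
def UniformlyExpandingInDim (k : ℕ) (μ : Measure (Diff d M)) : Prop :=
  ∃ C : ℝ, 0 < C ∧ ∃ N : ℕ, ∀ (x : M) (w : ⋀[ℝ]^k (TangentSpace (𝓡 d) x)),
    w ∈ Set.range (exteriorPower.ιMulti ℝ k) → ‖w‖ = 1 →
      C < ∫ f : Diff d M, Real.log ‖extPowDeriv k f x w‖ ∂(convPow μ N)

/-- Uniform expansion in all dimensions `1 ≤ k ≤ d - 1`. -/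
def UniformlyExpandingInAllDims (μ : Measure (Diff d M)) : Prop :=
  ∀ k : ℕ, 1 ≤ k → k < d → UniformlyExpandingInDim k μ

/-- `χ` is the Lyapunov exponent of `η` on `ℙ(⋀^k TM)`: for almost every `α = (f_0, f_1, …)` and
`(x, V)`, the vectors of `⋀^k T_x M` that represent `V` satisfy
`lim (1/n) log ‖D_x f^n_α v‖ = χ`. -/
def HasLyapunovExponent {k : ℕ} (μ : Measure (Diff d M)) (η : Measure (GrassmannBundle d k M))
    (χ : ℝ) : Prop :=
  ∀ᵐ p : (ℕ → Diff d M) × GrassmannBundle d k M ∂((Measure.infinitePi fun _ : ℕ => μ).prod η),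
    ∀ w : ⋀[ℝ]^k (TangentSpace (𝓡 d) p.2.base), PluckerRepresents p.2 w →
      Tendsto (fun n : ℕ => (1 / (n : ℝ)) * Real.log ‖extPowDeriv k (iterate p.1 n) p.2.base w‖)
        atTop (𝓝 χ)

end Riemannian

end

end RandomWalk

/-! For a diffeomorphism `f` and a plane `ξ`, `growth f ξ` is the logarithm of the factor by which
`f` changes `k`-volume on `ξ`. It is an additive cocycle over the action on the Grassmann bundle, so
its mean over `convPow μ N` is a sum over times `i < N` of the one-step drift `ψ ξ = ∫ growth f ξ
dμ`, averaged over the law of the walk at time `i` (`integral_growth_convPow`). If expansion fails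
in dimension `k`, then for every `N` some starting plane keeps this sum at most `1`. The empirical
laws then have mean drift at most `1/N`, and a weak limit is stationary with `∫ ψ ≤ 0`
(`exists_stationary_integral_nonpos`).

Ergodicity comes from convexity: among the stationary measures minimising `∫ ψ`, an extreme one is
ergodic (`exists_ergodic_stationary`). The skew product over the Bernoulli shift is then ergodic
(`ergodic_skew`), and Birkhoff's theorem applied to the cocycle gives the exponent `χ = ∫ ψ ≤ 0`.

Three facts make this work on the Grassmann bundle. It is compact and metrizable
(`isClosedEmbedding_grassmannEmb`). The action and the cocycle are continuous in the plane and
jointly measurable, although the σ-algebra on diffeomorphisms only sees point values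
(`measurable_euclidFrame`). The cocycle is bounded, since preservation of volume turns an upper
bound on the derivative into a lower bound on `k`-volumes (`abs_growth_le`). -/

namespace RandomWalk

/-! ### Volumes of wedges and Gram determinants. -/

section ExteriorNorm

/-- Two families with the same span (the first one independent) have proportional wedges. -/
theorem exists_ιMulti_eq_smul {V : Type*} [AddCommGroup V] [Module ℝ V] {k : ℕ} {v v' : Fin k → V}
    (hv : LinearIndependent ℝ v)
    (h : Submodule.span ℝ (Set.range v') ≤ Submodule.span ℝ (Set.range v)) :
    ∃ c : ℝ, exteriorPower.ιMulti ℝ k v' = c • exteriorPower.ιMulti ℝ k v := by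
  let b := Module.Basis.span hv
  have hmem : ∀ i, v' i ∈ Submodule.span ℝ (Set.range v) := fun i =>
    h (Submodule.subset_span ⟨i, rfl⟩)
  let g := (exteriorPower.ιMulti ℝ k (M := V)).compLinearMap
    (Submodule.span ℝ (Set.range v)).subtype
  -- An alternating `k`-form on a `k`-dimensional space is determined by its value on one basis.
  have key : g = (LinearMap.toSpanSingleton ℝ _ (g b)).compAlternatingMap b.det := by
    refine b.ext_alternating fun f hf => ?_
    obtain ⟨σ, rfl⟩ : ∃ σ : Equiv.Perm (Fin k), f = σ :=
      ⟨Equiv.ofBijective f (Finite.injective_iff_bijective.1 hf), rfl⟩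
    have e1 := g.map_perm b σ
    have e2 := b.det.map_perm b σ
    simp only [Function.comp_def] at e1 e2
    simp [e1, e2, Module.Basis.det_self]
  have := congrArg (fun f => f fun i => ⟨v' i, hmem i⟩) key
  refine ⟨b.det fun i => ⟨v' i, hmem i⟩, ?_⟩
  simp only [g, AlternatingMap.compLinearMap_apply, LinearMap.compAlternatingMap_apply,
    LinearMap.toSpanSingleton_apply, Submodule.subtype_apply] at this
  rw [this]
  congr 2
  ext i
  simp [b, Module.Basis.span_apply]

variable {E : Type*} [NormedAddCommGroup E] [InnerProductSpace ℝ E] [FiniteDimensional ℝ E]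

theorem norm_sq_ιMulti {k : ℕ} (v : Fin k → E) :
    ‖exteriorPower.ιMulti ℝ k v‖ ^ 2 = (Matrix.gram ℝ v).det := by
  rw [← exteriorPower.inner_ιMulti_self, real_inner_self_eq_norm_sq]

theorem norm_ιMulti {k : ℕ} (v : Fin k → E) :
    ‖exteriorPower.ιMulti ℝ k v‖ = √(Matrix.gram ℝ v).det := by
  rw [← norm_sq_ιMulti, Real.sqrt_sq (norm_nonneg _)]

theorem norm_ιMulti_pos {k : ℕ} {v : Fin k → E} (hv : LinearIndependent ℝ v) :
    0 < ‖exteriorPower.ιMulti ℝ k v‖ := by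
  rw [norm_ιMulti]
  exact Real.sqrt_pos.2 (Matrix.posDef_gram_of_linearIndependent hv).det_pos

theorem norm_ιMulti_of_orthonormal {k : ℕ} {v : Fin k → E} (hv : Orthonormal ℝ v) :
    ‖exteriorPower.ιMulti ℝ k v‖ = 1 := by
  rw [norm_ιMulti, Matrix.gram_eq_one_iff_orthonormal.2 hv, Matrix.det_one, Real.sqrt_one]

/-- The first row of the Gram matrix is `(‖q‖², 0, …, 0)`; expand along it. -/
theorem norm_ιMulti_cons_of_orthogonal {k : ℕ} {q : E} {v : Fin k → E}
    (h : ∀ i, inner ℝ q (v i) = 0) :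
    ‖exteriorPower.ιMulti ℝ (k + 1) (Fin.cons q v : Fin (k + 1) → E)‖ =
      ‖q‖ * ‖exteriorPower.ιMulti ℝ k v‖ := by
  have hsq : ‖exteriorPower.ιMulti ℝ (k + 1) (Fin.cons q v : Fin (k + 1) → E)‖ ^ 2 =
      (‖q‖ * ‖exteriorPower.ιMulti ℝ k v‖) ^ 2 := by
    rw [mul_pow, norm_sq_ιMulti, norm_sq_ιMulti, Matrix.det_succ_row_zero, Fin.sum_univ_succ,
      Finset.sum_eq_zero]
    · have : (Matrix.gram ℝ (Fin.cons q v : Fin (k + 1) → E)).submatrix Fin.succ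
          Fin.succ = Matrix.gram ℝ v := by
        ext i j; simp [Matrix.gram_apply]
      simp [this, Matrix.gram_apply]
    · intro i _
      simp [Matrix.gram_apply, h]
  exact (pow_left_inj₀ (norm_nonneg _) (by positivity) two_ne_zero).1 hsq

/-- The norm of `u ∧ v₁ ∧ ⋯ ∧ v_k` is that of `v₁ ∧ ⋯ ∧ v_k` times the distance from `u` to the
span of the `v_i`. -/
theorem norm_ιMulti_cons {k : ℕ} (u : E) (v : Fin k → E) :
    ‖exteriorPower.ιMulti ℝ (k + 1) (Fin.cons u v : Fin (k + 1) → E)‖ =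
      ‖u - (Submodule.span ℝ (Set.range v)).starProjection u‖ * ‖exteriorPower.ιMulti ℝ k v‖ := by
  set K := Submodule.span ℝ (Set.range v) with hK
  rw [← norm_ιMulti_cons_of_orthogonal]
  · congr 1
    -- The projection of `u` lies in the span of `v`, so subtracting it from `u` leaves the wedge
    -- unchanged.
    have h0 : exteriorPower.ιMulti ℝ (k + 1)
        (Fin.cons (K.starProjection u) v : Fin (k + 1) → E) = 0 := by
      refine AlternatingMap.map_linearDependent _ _ fun hli => ?_
      rw [linearIndependent_finCons] at hli
      exact hli.2 (Submodule.starProjection_apply_mem K u)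
    have := (exteriorPower.ιMulti ℝ (k + 1) (M := E)).curryLeft.map_sub u (K.starProjection u)
    have h2 := congrArg (fun f => f v) this
    simp only [AlternatingMap.curryLeft_apply_apply, AlternatingMap.sub_apply] at h2
    change _ = exteriorPower.ιMulti ℝ (k + 1) (Matrix.vecCons _ v)
    rw [h2]
    change _ = _ - exteriorPower.ιMulti ℝ (k + 1) (Fin.cons (K.starProjection u) v : Fin (k + 1) → E)
    rw [h0, sub_zero]; rfl
  · intro i
    exact (Submodule.mem_orthogonal' K _).1 (Submodule.sub_starProjection_mem_orthogonal u) _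
      (Submodule.subset_span ⟨i, rfl⟩)

theorem norm_ιMulti_cons_le {k : ℕ} (u : E) (v : Fin k → E) :
    ‖exteriorPower.ιMulti ℝ (k + 1) (Fin.cons u v : Fin (k + 1) → E)‖ ≤
      ‖u‖ * ‖exteriorPower.ιMulti ℝ k v‖ := by
  rw [norm_ιMulti_cons]
  gcongr
  set K := Submodule.span ℝ (Set.range v)
  have h := Submodule.norm_sq_eq_add_norm_sq_starProjection u K
  rw [Submodule.starProjection_orthogonal_val] at h
  exact (sq_le_sq₀ (norm_nonneg _) (norm_nonneg _)).1 (by nlinarith [sq_nonneg ‖K.starProjection u‖])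

/-- Hadamard's inequality, crude form. -/
theorem norm_ιMulti_le_pow {C : ℝ} {k : ℕ} (v : Fin k → E) (h : ∀ i, ‖v i‖ ≤ C) :
    ‖exteriorPower.ιMulti ℝ k v‖ ≤ C ^ k := by
  induction k with
  | zero => rw [norm_ιMulti]; simp
  | succ k ih =>
    rw [← Fin.cons_self_tail v]
    have hC : 0 ≤ C := (norm_nonneg _).trans (h 0)
    calc _ ≤ ‖v 0‖ * ‖exteriorPower.ιMulti ℝ k (Fin.tail v)‖ := norm_ιMulti_cons_le _ _
      _ ≤ C * C ^ k := mul_le_mul (h 0) (ih _ fun i => h i.succ) (norm_nonneg _) hC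
      _ = _ := (pow_succ' C k).symm

/-- A lower bound for the volume of the image of an orthonormal family under a map which does not
decrease the total volume. -/
theorem one_le_pow_mul_norm_ιMulti {F : Type*} [NormedAddCommGroup F] [InnerProductSpace ℝ F]
    [FiniteDimensional ℝ F] (L : E →ₗ[ℝ] F) {C : ℝ} (hC : ∀ v, ‖L v‖ ≤ C * ‖v‖) {d : ℕ}
    (hd : Module.finrank ℝ E = d) (hC0 : 0 ≤ C)
    (hvol : ∀ w : ⋀[ℝ]^d E, ‖exteriorPower.map d L w‖ = ‖w‖) (m : ℕ) :
    ∀ {k : ℕ} (_ : k + m = d) {v : Fin k → E} (_ : Orthonormal ℝ v),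
      1 ≤ C ^ m * ‖exteriorPower.ιMulti ℝ k (L ∘ v)‖ := by
  induction m with
  | zero =>
    intro k hk v hv
    obtain rfl : k = d := hk
    have := hvol (exteriorPower.ιMulti ℝ _ v)
    rw [exteriorPower.map_apply_ιMulti, norm_ιMulti_of_orthonormal hv] at this
    simpa using this.ge
  | succ m ih =>
    intro k hk v hv
    -- Adjoin a unit vector orthogonal to `K`. It costs at most a factor `C`, and after `m` such
    -- steps the family has `d` vectors, where the volume is preserved.
    set K := Submodule.span ℝ (Set.range v) with hK
    have hKtop : K ≠ ⊤ := by
      intro h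
      have h1 := finrank_span_eq_card hv.linearIndependent
      rw [← hK, h, finrank_top, hd, Fintype.card_fin] at h1
      omega
    have hKo : Kᗮ ≠ ⊥ := fun h => hKtop ((Submodule.orthogonal_eq_bot_iff).1 h)
    obtain ⟨q, hq, hq0⟩ := Submodule.exists_mem_ne_zero_of_ne_bot hKo
    set u : E := ‖q‖⁻¹ • q with hu
    have hun : ‖u‖ = 1 := by rw [hu, norm_smul, norm_inv, norm_norm,
      inv_mul_cancel₀ (norm_ne_zero_iff.2 hq0)]
    have huo : ∀ i, inner ℝ u (v i) = 0 := fun i =>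
      (Submodule.mem_orthogonal' K _).1 (Submodule.smul_mem _ _ hq) _
        (Submodule.subset_span ⟨i, rfl⟩)
    have ho : Orthonormal ℝ (Fin.cons u v : Fin (k + 1) → E) := by
      refine ⟨fun i => ?_, fun i j hij => ?_⟩
      · refine Fin.cases ?_ (fun i => ?_) i
        · simpa using hun
        · simpa using hv.1 i
      · revert hij
        refine Fin.cases ?_ (fun i => ?_) i <;> refine Fin.cases ?_ (fun j => ?_) j <;> intro hij
        · exact absurd rfl hij
        · simpa using huo j
        · simpa [real_inner_comm] using huo i
        · simpa using hv.2 fun h => hij (by rw [h])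
    have h1 := ih (k := k + 1) (by omega) ho
    have h2 : L ∘ (Fin.cons u v : Fin (k + 1) → E) = Fin.cons (L u) (L ∘ v) := by
      ext i
      refine Fin.cases ?_ (fun i => ?_) i <;> simp
    rw [h2] at h1
    calc 1 ≤ _ := h1
      _ ≤ C ^ m * (C * ‖exteriorPower.ιMulti ℝ k (L ∘ v)‖) := by
        gcongr
        refine (norm_ιMulti_cons_le _ _).trans ?_
        gcongr
        simpa [hun] using hC u
      _ = _ := by ring

end ExteriorNorm

/-! ### Birkhoff's ergodic theorem. -/

section Birkhoff

variable {Ω : Type*} {T : Ω → Ω} {h : Ω → ℝ}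

/-- The running maximum of `0` and the Birkhoff sums of `h` up to time `n`. -/
noncomputable def maxBirkhoff (T : Ω → Ω) (h : Ω → ℝ) : ℕ → Ω → ℝ
  | 0 => fun _ => 0
  | n + 1 => fun x => max 0 (h x + maxBirkhoff T h n (T x))

theorem maxBirkhoff_nonneg (n : ℕ) (x : Ω) : 0 ≤ maxBirkhoff T h n x := by
  cases n with
  | zero => exact le_rfl
  | succ n => exact le_max_left _ _

theorem maxBirkhoff_mono (x : Ω) : Monotone fun n => maxBirkhoff T h n x := by
  refine monotone_nat_of_le_succ fun n => ?_
  induction n generalizing x with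
  | zero => exact maxBirkhoff_nonneg 1 x
  | succ n ih => exact max_le_max le_rfl (add_le_add le_rfl (ih (T x)))

theorem birkhoffSum_le_maxBirkhoff (n : ℕ) (x : Ω) :
    birkhoffSum T h n x ≤ maxBirkhoff T h n x := by
  induction n generalizing x with
  | zero => simp [maxBirkhoff]
  | succ n ih =>
    rw [birkhoffSum_succ']
    exact (add_le_add le_rfl (ih (T x))).trans (le_max_right _ _)

/-- Dropping or adding one term changes the sums by a finite amount. This makes the set of bounded
orbits exactly `T`-invariant, hence trivial under ergodicity. -/
theorem bddAbove_maxBirkhoff_iff (x : Ω) :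
    (∃ B, ∀ n, maxBirkhoff T h n (T x) ≤ B) ↔ ∃ B, ∀ n, maxBirkhoff T h n x ≤ B := by
  constructor
  · rintro ⟨B, hB⟩
    refine ⟨max 0 (h x + B), fun n => ?_⟩
    cases n with
    | zero => exact le_max_left _ _
    | succ n => exact max_le_max le_rfl (add_le_add le_rfl (hB n))
  · rintro ⟨B, hB⟩
    refine ⟨B - h x, fun n => ?_⟩
    have := (le_max_right _ _).trans (hB (n + 1))
    linarith

variable [MeasurableSpace Ω] {ν : Measure Ω}

theorem measurable_maxBirkhoff (hT : Measurable T) (hm : Measurable h) (n : ℕ) :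
    Measurable (maxBirkhoff T h n) := by
  induction n with
  | zero => exact measurable_const
  | succ n ih => exact measurable_const.max (hm.add (ih.comp hT))

theorem integrable_maxBirkhoff (hT : MeasurePreserving T ν ν) (hi : Integrable h ν) (n : ℕ) :
    Integrable (maxBirkhoff T h n) ν := by
  induction n with
  | zero => exact integrable_zero _ _ _
  | succ n ih => exact (integrable_zero _ _ _).sup (hi.add (hT.integrable_comp_of_integrable ih))

variable [IsProbabilityMeasure ν]

/-- A consequence of the maximal ergodic theorem. -/
theorem ae_bddAbove_birkhoffSum (hT : Ergodic T ν) (hm : Measurable h) (hi : Integrable h ν)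
    (hneg : ∫ x, h x ∂ν < 0) : ∀ᵐ x ∂ν, ∃ B, ∀ n, birkhoffSum T h n x ≤ B := by
  set A : Set Ω := {x | ∃ B, ∀ n, maxBirkhoff T h n x ≤ B} with hA
  have hAm : MeasurableSet A := by
    have : A = ⋃ k : ℕ, ⋂ n, {x | maxBirkhoff T h n x ≤ k} := by
      ext x
      simp only [hA, Set.mem_ofPred_eq, Set.mem_iUnion, Set.mem_iInter]
      refine ⟨fun ⟨B, hB⟩ => ?_, fun ⟨k, hk⟩ => ⟨k, hk⟩⟩
      obtain ⟨k, hk⟩ := exists_nat_ge B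
      exact ⟨k, fun n => (hB n).trans hk⟩
    rw [this]
    exact .iUnion fun k => .iInter fun n =>
      measurableSet_le (measurable_maxBirkhoff hT.measurable hm n) measurable_const
  have hinv : T ⁻¹' A = A := by
    ext x; exact bddAbove_maxBirkhoff_iff x
  rcases hT.prob_eq_zero_or_one hAm hinv with h0 | h1
  · exfalso
    have hae : ∀ᵐ x ∂ν, x ∉ A := measure_eq_zero_iff_ae_notMem.1 h0
    -- The integrand equals `max (-M_n(T x)) (h x)`, with `M_n` the running maximum. It is dominated
    -- by `|h|` and tends to `h` where `M_n(T x)` is unbounded. Its integral is nonnegative by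
    -- monotonicity of `M_n` and invariance of `ν`, which contradicts `∫ h < 0`.
    have hlim : Tendsto (fun n => ∫ x, (maxBirkhoff T h (n + 1) x - maxBirkhoff T h n (T x)) ∂ν)
        atTop (𝓝 (∫ x, h x ∂ν)) := by
      refine tendsto_integral_of_dominated_convergence (fun x => |h x|) (fun n => ?_) hi.abs
        (fun n => ?_) ?_
      · exact ((measurable_maxBirkhoff hT.measurable hm _).sub
          ((measurable_maxBirkhoff hT.measurable hm _).comp hT.measurable)).aestronglyMeasurable
      · refine .of_forall fun x => ?_
        have := maxBirkhoff_nonneg (T := T) (h := h) n (T x)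
        simp only [maxBirkhoff, Real.norm_eq_abs]
        rcases max_cases 0 (h x + maxBirkhoff T h n (T x)) with ⟨e, _⟩ | ⟨e, _⟩ <;> rw [e]
        · rw [abs_le]; constructor <;> linarith [neg_abs_le (h x), abs_nonneg (h x)]
        · simp
      · filter_upwards [hae] with x hx
        refine tendsto_const_nhds.congr' ?_
        rw [← hinv] at hx
        simp only [hA, Set.mem_preimage, Set.mem_ofPred_eq, not_exists, not_forall, not_le] at hx
        obtain ⟨N, hN⟩ := hx (-h x)
        filter_upwards [eventually_ge_atTop N] with n hn
        have := maxBirkhoff_mono (T := T) (h := h) (T x) hn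
        simp only [maxBirkhoff] at this ⊢
        rw [max_eq_right] <;> linarith
    refine absurd (ge_of_tendsto' hlim fun n => ?_) hneg.not_ge
    have hin := integrable_maxBirkhoff hT.toMeasurePreserving hi
    have hin' : Integrable (fun x => maxBirkhoff T h n (T x)) ν :=
      hT.toMeasurePreserving.integrable_comp_of_integrable (hin n)
    rw [integral_sub (hin (n + 1)) hin', sub_nonneg]
    have : ∫ x, maxBirkhoff T h n (T x) ∂ν = ∫ x, maxBirkhoff T h n x ∂ν := by
      conv_rhs => rw [← hT.map_eq]
      exact (integral_map hT.measurable.aemeasurable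
        (measurable_maxBirkhoff hT.measurable hm n).aestronglyMeasurable).symm
    rw [this]
    exact integral_mono (hin _) (hin _) fun x => maxBirkhoff_mono x n.le_succ
  · have : ∀ᵐ x ∂ν, x ∈ A := (prob_compl_eq_zero_iff hAm).2 h1
    filter_upwards [this] with x ⟨B, hB⟩
    exact ⟨B, fun n => (birkhoffSum_le_maxBirkhoff n x).trans (hB n)⟩

/-- Subtracting the mean plus `ε/2` makes the integral negative, so the sums are bounded above; the
other `ε/2` per step absorbs the bound. -/
theorem ae_eventually_birkhoffSum_le (hT : Ergodic T ν) (hm : Measurable h) (hi : Integrable h ν)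
    {ε : ℝ} (hε : 0 < ε) :
    ∀ᵐ x ∂ν, ∀ᶠ n : ℕ in atTop, birkhoffSum T h n x ≤ n * (∫ x, h x ∂ν + ε) := by
  set c := ∫ x, h x ∂ν
  have key := ae_bddAbove_birkhoffSum (h := fun x => h x - (c + ε / 2)) hT (hm.sub_const _)
    (hi.sub (integrable_const _)) (by
      rw [integral_sub hi (integrable_const _)]; simp only [integral_const, probReal_univ, one_smul]
      linarith)
  filter_upwards [key] with x ⟨B, hB⟩
  obtain ⟨N, hN⟩ := exists_nat_ge (B / (ε / 2))
  filter_upwards [eventually_ge_atTop N] with n hn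
  have h1 := hB n
  simp only [birkhoffSum, Finset.sum_sub_distrib, Finset.sum_const, Finset.card_range,
    nsmul_eq_mul] at h1 ⊢
  have h2 : B ≤ n * (ε / 2) := by
    rw [div_le_iff₀ (by positivity)] at hN
    exact hN.trans (by gcongr)
  linarith

/-- **Birkhoff's ergodic theorem** for ergodic maps. -/
theorem ae_tendsto_birkhoffAverage (hT : Ergodic T ν) (hm : Measurable h) (hi : Integrable h ν) :
    ∀ᵐ x ∂ν, Tendsto (fun n : ℕ => (1 / (n : ℝ)) * birkhoffSum T h n x) atTop
      (𝓝 (∫ x, h x ∂ν)) := by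
  have h1 : ∀ᵐ x ∂ν, ∀ j : ℕ, ∀ᶠ n : ℕ in atTop,
      birkhoffSum T h n x ≤ n * (∫ x, h x ∂ν + 1 / ((j : ℝ) + 1)) :=
    ae_all_iff.2 fun j => ae_eventually_birkhoffSum_le hT hm hi (by positivity)
  have h2 : ∀ᵐ x ∂ν, ∀ j : ℕ, ∀ᶠ n : ℕ in atTop,
      birkhoffSum T (fun x => -h x) n x ≤ n * (∫ x, -h x ∂ν + 1 / ((j : ℝ) + 1)) :=
    ae_all_iff.2 fun j => ae_eventually_birkhoffSum_le hT hm.neg hi.neg (by positivity)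
  filter_upwards [h1, h2] with x hx1 hx2
  rw [Metric.tendsto_atTop']
  intro ε hε
  obtain ⟨j, hj⟩ := exists_nat_one_div_lt hε
  obtain ⟨N, hN⟩ := eventually_atTop.1 ((hx1 j).and ((hx2 j).and (eventually_gt_atTop 0)))
  refine ⟨N, fun n hn => ?_⟩
  obtain ⟨a, b, hn0⟩ := hN n hn.le
  have hn0' : (0 : ℝ) < n := by exact_mod_cast hn0
  simp only [birkhoffSum, Finset.sum_neg_distrib, integral_neg] at a b ⊢
  rw [Real.dist_eq, abs_lt, one_div, inv_mul_eq_div, lt_sub_iff_add_lt, sub_lt_iff_lt_add,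
    lt_div_iff₀ hn0', div_lt_iff₀ hn0']
  constructor <;> nlinarith

end Birkhoff

/-! ### Ergodicity of the skew product over the Bernoulli shift. -/

section SkewProduct

/-- Every set which is invariant modulo `η` under `μ`-almost every map is trivial. -/
def ErgodicFor {X Y : Type*} [MeasurableSpace X] [MeasurableSpace Y] (F : X → Y → Y) (μ : Measure X) (η : Measure Y) : Prop :=
  ∀ A : Set Y, MeasurableSet A → (∀ᵐ a ∂μ, η (symmDiff (F a ⁻¹' A) A) = 0) → η A = 0 ∨ η A = 1

/-- Every preimage `g ⁻¹' U` is invariant modulo `η`, hence null or conull, and measurable sets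
separate the points of the line. -/
theorem ErgodicFor.ae_eq_const {X Y : Type*} [MeasurableSpace X] [MeasurableSpace Y]
    {μ : Measure X} {F : X → Y → Y} {η : Measure Y} [IsProbabilityMeasure η]
    (he : ErgodicFor F μ η) {g : Y → ℝ} (hg : Measurable g)
    (hinv : ∀ᵐ p ∂(μ.prod η), g (F p.1 p.2) = g p.2) : ∃ c, ∀ᵐ y ∂η, g y = c := by
  have := exists_eventuallyEq_const_of_forall_separating (l := ae η) (f := g) MeasurableSet
    fun U hU => ?_
  · exact this
  have hA : MeasurableSet (g ⁻¹' U) := hg hU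
  have h1 : ∀ᵐ a ∂μ, η (symmDiff (F a ⁻¹' (g ⁻¹' U)) (g ⁻¹' U)) = 0 := by
    filter_upwards [Measure.ae_ae_of_ae_prod hinv] with a ha
    rw [measure_symmDiff_eq_zero_iff]
    filter_upwards [ha] with y hy
    exact propext (by change g (F a y) ∈ U ↔ g y ∈ U; rw [hy])
  rcases he _ hA h1 with h | h
  · exact .inr (measure_eq_zero_iff_ae_notMem.1 h)
  · exact .inl ((prob_compl_eq_zero_iff hA).2 h)

variable {X Y : Type*}

/-- Put a term in front of a sequence. -/
def seqCons (a : X) (α : ℕ → X) : ℕ → X := fun n => Nat.casesOn n a α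

@[simp] theorem seqCons_zero (a : X) (α : ℕ → X) : seqCons a α 0 = a := rfl

@[simp] theorem seqCons_succ (a : X) (α : ℕ → X) (n : ℕ) : seqCons a α (n + 1) = α n := rfl

variable [MeasurableSpace X] [MeasurableSpace Y]

theorem measurable_seqCons : Measurable fun p : X × (ℕ → X) => seqCons p.1 p.2 := by
  refine measurable_pi_lambda _ fun n => ?_
  cases n with
  | zero => exact measurable_fst
  | succ n => exact (measurable_pi_apply n).comp measurable_snd

/-- A box with finitely many constraints, written as a box over an initial segment. -/
theorem exists_range_pi_eq (s : Finset ℕ) (t : ℕ → Set X) (ht : ∀ i, MeasurableSet (t i)) :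
    ∃ (N : ℕ) (t' : ℕ → Set X), (∀ i, MeasurableSet (t' i)) ∧
      ((s : Set ℕ).pi t = {α | ∀ i < N, α i ∈ t' i}) ∧
      ∀ μ : Measure X, IsProbabilityMeasure μ →
        ∏ i ∈ s, μ (t i) = ∏ i ∈ Finset.range N, μ (t' i) := by
  classical
  obtain ⟨N, hN⟩ := s.exists_nat_subset_range
  refine ⟨N, fun i => if i ∈ s then t i else Set.univ, fun i => ?_, ?_, fun μ _ => ?_⟩
  · dsimp only; split_ifs; exacts [ht i, .univ]
  · ext α
    simp only [Set.mem_pi, SetLike.mem_coe, Set.mem_ofPred_eq]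
    refine ⟨fun h i _ => ?_, fun h i hi => ?_⟩
    · split_ifs with hi
      exacts [h i hi, trivial]
    · simpa [hi] using h i (Finset.mem_range.1 (hN hi))
  · rw [← Finset.prod_subset hN]
    · exact Finset.prod_congr rfl fun i hi => by simp [hi]
    · intro i _ hi; simp [hi]

theorem measurableSet_range_pi (N : ℕ) (t : ℕ → Set X) (ht : ∀ i, MeasurableSet (t i)) :
    MeasurableSet {α : ℕ → X | ∀ i < N, α i ∈ t i} := by
  simp only [Set.ofPred_forall]
  exact .iInter fun i => .iInter fun _ => measurable_pi_apply i (ht i)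

variable (μ : Measure X) [IsProbabilityMeasure μ]

/-- The law of an i.i.d. sequence. -/
noncomputable abbrev iidMeasure : Measure (ℕ → X) := Measure.infinitePi fun _ : ℕ => μ

theorem iidMeasure_range_pi (N : ℕ) (t : ℕ → Set X) (ht : ∀ i, MeasurableSet (t i)) :
    iidMeasure μ {α | ∀ i < N, α i ∈ t i} = ∏ i ∈ Finset.range N, μ (t i) := by
  rw [← Measure.infinitePi_pi (μ := fun _ : ℕ => μ) fun i _ => ht i]
  congr 1
  ext α
  simp

/-- An independent term put in front of an i.i.d. sequence leaves it i.i.d. Integrating out that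
first term reduces statements about sequences to one-step statements on `Y`. -/
theorem map_seqCons :
    (μ.prod (iidMeasure μ)).map (fun p => seqCons p.1 p.2) = iidMeasure μ := by
  refine Measure.eq_infinitePi _ fun s t ht => ?_
  obtain ⟨N, t', ht', hbox, hprod⟩ := exists_range_pi_eq s t ht
  rw [hbox, hprod μ inferInstance]
  rw [Measure.map_apply measurable_seqCons (measurableSet_range_pi N t' ht')]
  cases N with
  | zero => simp
  | succ N =>
    have : (fun p : X × (ℕ → X) => seqCons p.1 p.2) ⁻¹' {α | ∀ i < N + 1, α i ∈ t' i} =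
        t' 0 ×ˢ {α | ∀ i < N, α i ∈ t' (i + 1)} := by
      ext p
      simp only [Set.mem_preimage, Set.mem_ofPred_eq, Set.mem_prod]
      refine ⟨fun h => ⟨h 0 (by omega), fun i hi => h (i + 1) (by omega)⟩, fun h i hi => ?_⟩
      cases i with
      | zero => exact h.1
      | succ i => exact h.2 i (by omega)
    rw [this, Measure.prod_prod, iidMeasure_range_pi μ N _ fun i => ht' _,
      Finset.prod_range_succ', mul_comm]

theorem iidMeasure_apply {B : Set (ℕ → X)} (hB : MeasurableSet B) :
    iidMeasure μ B = ∫⁻ a, iidMeasure μ {α | seqCons a α ∈ B} ∂μ := by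
  conv_lhs => rw [← map_seqCons, Measure.map_apply measurable_seqCons hB,
    Measure.prod_apply (measurable_seqCons hB)]
  rfl

/-- The skew product over the shift. -/
def skew (F : X → Y → Y) (p : (ℕ → X) × Y) : (ℕ → X) × Y := (fun n => p.1 (n + 1), F (p.1 0) p.2)

variable {μ} {F : X → Y → Y} {η : Measure Y} [IsProbabilityMeasure η]

theorem lintegral_stationary (hF : Measurable (Function.uncurry F))
    (hη : (μ.prod η).map (Function.uncurry F) = η) {H : Y → ENNReal} (hH : Measurable H) :
    ∫⁻ y, ∫⁻ a, H (F a y) ∂μ ∂η = ∫⁻ y, H y ∂η := by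
  conv_rhs => rw [← hη]
  rw [lintegral_map hH hF]
  exact (lintegral_prod_symm _ (hH.comp hF).aemeasurable).symm

theorem ae_ae_of_stationary (hF : Measurable (Function.uncurry F))
    (hη : (μ.prod η).map (Function.uncurry F) = η) {P : Y → Prop} (h : ∀ᵐ y ∂η, P y) :
    ∀ᵐ y ∂η, ∀ᵐ a ∂μ, P (F a y) := by
  rw [← hη] at h
  have h1 := ae_of_ae_map hF.aemeasurable h
  rw [← Measure.prod_swap] at h1
  exact Measure.ae_ae_of_ae_prod (ae_of_ae_map measurable_swap.aemeasurable h1)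

theorem measurable_skew (hF : Measurable (Function.uncurry F)) : Measurable (skew F) := by
  refine Measurable.prodMk ?_ ?_
  · exact measurable_pi_lambda _ fun n => (measurable_pi_apply _).comp measurable_fst
  · have : Measurable fun p : (ℕ → X) × Y => (p.1 0, p.2) :=
      ((measurable_pi_apply 0).comp measurable_fst).prodMk measurable_snd
    exact hF.comp this

theorem measurePreserving_skew (hF : Measurable (Function.uncurry F))
    (hη : (μ.prod η).map (Function.uncurry F) = η) :
    MeasurePreserving (skew F) ((iidMeasure μ).prod η) ((iidMeasure μ).prod η) := by
  refine ⟨measurable_skew hF, ?_⟩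
  ext B hB
  rw [Measure.map_apply (measurable_skew hF) hB, Measure.prod_apply_symm (measurable_skew hF hB),
    Measure.prod_apply_symm hB, ← lintegral_stationary hF hη (measurable_measure_prodMk_right hB)]
  refine lintegral_congr fun y => ?_
  rw [iidMeasure_apply μ (measurable_prodMk_right (measurable_skew hF hB))]
  rfl

/-- A bounded harmonic function is invariant. -/
theorem ae_invariant_of_harmonic (hF : Measurable (Function.uncurry F))
    (hη : (μ.prod η).map (Function.uncurry F) = η) {g : Y → ℝ} (hg : Measurable g)
    (hg1 : ∀ y, |g y| ≤ 1) (hharm : ∀ y, ∫ a, g (F a y) ∂μ = g y) :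
    ∀ᵐ p ∂(μ.prod η), g (F p.1 p.2) = g p.2 := by
  have hgF : Measurable fun p : X × Y => g (F p.1 p.2) := hg.comp hF
  have hg2 : Measurable fun p : X × Y => g p.2 := hg.comp measurable_snd
  have int : ∀ {f : X × Y → ℝ}, Measurable f → (∀ p, |f p| ≤ 1) → Integrable f (μ.prod η) :=
    fun hf hb => Integrable.of_bound hf.aestronglyMeasurable 1 (.of_forall hb)
  have i1 : Integrable (fun p : X × Y => g (F p.1 p.2) ^ 2) (μ.prod η) :=
    int (hgF.pow_const 2) fun p => by rw [abs_pow]; exact pow_le_one₀ (abs_nonneg _) (hg1 _)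
  have i2 : Integrable (fun p : X × Y => g (F p.1 p.2) * g p.2) (μ.prod η) :=
    int (hgF.mul hg2) fun p => by
      rw [abs_mul]; exact mul_le_one₀ (hg1 _) (abs_nonneg _) (hg1 _)
  have i3 : Integrable (fun p : X × Y => g p.2 ^ 2) (μ.prod η) :=
    int (hg2.pow_const 2) fun p => by rw [abs_pow]; exact pow_le_one₀ (abs_nonneg _) (hg1 _)
  have e1 : ∫ p, g (F p.1 p.2) ^ 2 ∂(μ.prod η) = ∫ y, g y ^ 2 ∂η := by
    conv_rhs => rw [← hη]
    rw [integral_map hF.aemeasurable (hg.pow_const 2).aestronglyMeasurable]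
    rfl
  have e2 : ∫ p, g (F p.1 p.2) * g p.2 ∂(μ.prod η) = ∫ y, g y ^ 2 ∂η := by
    rw [integral_prod_symm _ i2]
    refine integral_congr_ae (.of_forall fun y => ?_)
    simp only [integral_mul_const, hharm, sq]
  have e3 : ∫ p : X × Y, g p.2 ^ 2 ∂(μ.prod η) = ∫ y, g y ^ 2 ∂η := by
    rw [integral_prod_symm _ i3]
    simp
  -- Expand the square: stationarity evaluates the first term and harmonicity the cross term, giving
  -- `‖g‖² - 2‖g‖² + ‖g‖² = 0` in `L²(η)`.
  have hsq : ∫ p : X × Y, (g (F p.1 p.2) - g p.2) ^ 2 ∂(μ.prod η) = 0 := by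
    have : ∀ p : X × Y, (g (F p.1 p.2) - g p.2) ^ 2 =
        g (F p.1 p.2) ^ 2 - 2 * (g (F p.1 p.2) * g p.2) + g p.2 ^ 2 := fun p => by ring
    simp only [this]
    have i4 : Integrable (fun p : X × Y => g (F p.1 p.2) ^ 2 - 2 * (g (F p.1 p.2) * g p.2))
      (μ.prod η) := i1.sub (i2.const_mul 2)
    rw [integral_add i4 i3, integral_sub i1 (i2.const_mul 2), integral_const_mul, e1, e2, e3]
    ring
  have hint : Integrable (fun p : X × Y => (g (F p.1 p.2) - g p.2) ^ 2) (μ.prod η) :=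
    ((i1.sub (i2.const_mul 2)).add i3).congr (.of_forall fun p => by
      simp only [Pi.add_apply, Pi.sub_apply]; ring)
  filter_upwards [(integral_eq_zero_iff_of_nonneg (fun p => sq_nonneg _) hint).1 hsq] with p hp
  exact sub_eq_zero.1 (pow_eq_zero_iff two_ne_zero |>.1 hp)

/-- The measure `G y` of the fibre of an invariant set `A` over `y` is harmonic, hence invariant,
hence a constant `c`. The same constant appears after conditioning on finitely many coordinates, so
`A` is independent of every box and therefore of itself: `c = c²`. -/
theorem ergodic_skew (hF : Measurable (Function.uncurry F))
    (hη : (μ.prod η).map (Function.uncurry F) = η) (he : ErgodicFor F μ η) :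
    Ergodic (skew F) ((iidMeasure μ).prod η) := by
  refine ⟨measurePreserving_skew hF hη, ⟨fun {A} hA hinv => ?_⟩⟩
  set ν := (iidMeasure μ).prod η with hν
  have hinv' : ∀ a α y, (seqCons a α, y) ∈ A ↔ (α, F a y) ∈ A := fun a α y => by
    conv_lhs => rw [← hinv]
    rfl
  set G : Y → ENNReal := fun y => iidMeasure μ {α | (α, y) ∈ A} with hG
  have hGm : Measurable G := measurable_measure_prodMk_right hA
  have hsec : ∀ y, MeasurableSet {α | (α, y) ∈ A} := fun y => measurable_prodMk_right hA
  have hGh : ∀ y, G y = ∫⁻ a, G (F a y) ∂μ := fun y => by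
    rw [hG]
    dsimp only
    rw [iidMeasure_apply μ (hsec y)]
    simp only [Set.mem_ofPred_eq, hinv']
  have hG1 : ∀ y, G y ≤ 1 := fun y => prob_le_one
  obtain ⟨c, hc⟩ : ∃ c : ENNReal, ∀ᵐ y ∂η, G y = c := by
    have hgm : Measurable fun y => (G y).toReal := hGm.ennreal_toReal
    have hb : ∀ y, |(G y).toReal| ≤ 1 := fun y => by
      rw [abs_of_nonneg ENNReal.toReal_nonneg]
      exact ENNReal.toReal_mono ENNReal.one_ne_top (hG1 y)
    have hh : ∀ y, ∫ a, (G (F a y)).toReal ∂μ = (G y).toReal := fun y => by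
      have hm : Measurable fun a => G (F a y) := hGm.comp (hF.comp measurable_prodMk_right)
      rw [integral_toReal hm.aemeasurable, ← hGh]
      exact .of_forall fun a => (hG1 _).trans_lt ENNReal.one_lt_top
    obtain ⟨c, hc⟩ := he.ae_eq_const hgm (ae_invariant_of_harmonic hF hη hgm hb hh)
    refine ⟨ENNReal.ofReal c, ?_⟩
    filter_upwards [hc] with y hy
    rw [← hy, ENNReal.ofReal_toReal ((hG1 y).trans_lt ENNReal.one_lt_top).ne]
  -- Peel off the first coordinate `a`: invariance of `A` moves the fibre from `y` to `F a y`, where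
  -- the induction hypothesis holds for almost every `(a, y)` by stationarity.
  have hbox : ∀ (n : ℕ) (t : ℕ → Set X), (∀ i, MeasurableSet (t i)) →
      ∀ᵐ y ∂η, iidMeasure μ {α | (∀ i < n, α i ∈ t i) ∧ (α, y) ∈ A} =
        c * ∏ i ∈ Finset.range n, μ (t i) := by
    intro n
    induction n with
    | zero =>
      intro t _
      filter_upwards [hc] with y hy
      simpa using hy
    | succ n ih =>
      intro t ht
      filter_upwards [ae_ae_of_stationary hF hη (ih (fun i => t (i + 1)) fun i => ht _)] with y hy
      have hm : MeasurableSet {α : ℕ → X | (∀ i < n + 1, α i ∈ t i) ∧ (α, y) ∈ A} := by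
        refine MeasurableSet.inter ?_ (hsec y)
        exact measurableSet_range_pi (n + 1) t ht
      rw [iidMeasure_apply μ hm]
      calc _ = ∫⁻ a, (t 0).indicator
            (fun _ => c * ∏ i ∈ Finset.range n, μ (t (i + 1))) a ∂μ := by
            refine lintegral_congr_ae ?_
            filter_upwards [hy] with a ha
            by_cases h0 : a ∈ t 0
            · rw [Set.indicator_of_mem h0, ← ha]
              congr 1
              ext α
              simp only [Set.mem_ofPred_eq, hinv']
              refine and_congr_left fun _ => ⟨fun h i hi => h (i + 1) (by omega), fun h i hi => ?_⟩
              cases i with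
              | zero => exact h0
              | succ i => exact h i (by omega)
            · rw [Set.indicator_of_notMem h0]
              convert measure_empty (μ := iidMeasure μ)
              exact Set.eq_empty_of_forall_notMem fun α h => h0 (h.1 0 (by omega))
        _ = _ := by
            rw [lintegral_indicator_const (ht 0), Finset.prod_range_succ', mul_assoc]
  have hAc : ν A = c := by
    rw [hν, Measure.prod_apply_symm hA]
    calc _ = ∫⁻ _, c ∂η := lintegral_congr_ae (by filter_upwards [hc] with y hy using hy)
      _ = c := by simp
  have hc1 : c ≤ 1 := hAc ▸ prob_le_one
  have hrestr : ν.restrict A = c • ν := by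
    have hm0 := (MeasureTheory.generateFrom_squareCylinders (ι := ℕ) (α := fun _ => X))
    refine ext_of_generate_finite _ (generateFrom_eq_prod hm0
      MeasurableSpace.generateFrom_measurableSet ?_ isCountablySpanning_measurableSet).symm ?_ ?_ ?_
    · exact ⟨fun _ => Set.univ, fun _ => ⟨∅, fun _ => Set.univ, by simp, by simp⟩,
        Set.iUnion_const _⟩
    · exact (isPiSystem_squareCylinders (fun _ => MeasurableSpace.isPiSystem_measurableSet)
        (by simp)).prod MeasurableSpace.isPiSystem_measurableSet
    · rintro _ ⟨_, ⟨s, t, ht, rfl⟩, C, hC, rfl⟩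
      simp only [Set.mem_univ_pi, Set.mem_ofPred_eq] at ht hC
      have hSm : MeasurableSet ((s : Set ℕ).pi t) :=
        MeasurableSet.pi (Finset.countable_toSet _) fun i _ => ht i
      obtain ⟨N, t', ht', hb, hprod⟩ := exists_range_pi_eq s t ht
      rw [Measure.restrict_apply (hSm.prod hC), Measure.smul_apply, smul_eq_mul, hν,
        Measure.prod_prod, Measure.infinitePi_pi _ fun i _ => ht i, hprod μ inferInstance,
        Measure.prod_apply_symm ((hSm.prod hC).inter hA), hb]
      calc _ = ∫⁻ y, C.indicator (fun _ => c * ∏ i ∈ Finset.range N, μ (t' i)) y ∂η := by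
            refine lintegral_congr_ae ?_
            filter_upwards [hbox N t' ht'] with y hy
            by_cases hyC : y ∈ C
            · rw [Set.indicator_of_mem hyC, ← hy]
              congr 1
              ext α
              simp [hyC]
            · rw [Set.indicator_of_notMem hyC]
              convert measure_empty (μ := iidMeasure μ)
              exact Set.eq_empty_of_forall_notMem fun α h => hyC h.1.2
        _ = _ := by rw [lintegral_indicator_const hC, mul_assoc]
    · rw [Measure.restrict_apply .univ, Set.univ_inter, hAc]; simp
  have hcc : c = c * c := by
    have := congrArg (fun m => m A) hrestr
    simpa [Measure.restrict_apply hA, hAc] using this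
  rw [eventuallyConst_set']
  have hc01 : c = 0 ∨ c = 1 := by
    by_cases h0 : c = 0
    · exact .inl h0
    · right
      have hct : c ≠ ⊤ := (hc1.trans_lt ENNReal.one_lt_top).ne
      exact ((ENNReal.mul_right_inj h0 hct).1 ((mul_one c).trans hcc)).symm
  rcases hc01 with h | h
  · left
    exact ae_eq_empty.2 (hAc.trans h)
  · right
    exact (ae_eq_univ).2 ((prob_compl_eq_zero_iff hA).2 (hAc.trans h))

end SkewProduct

/-! ### Stationary measures on a compact space: existence and ergodicity. -/

section StationaryMeasures

open BoundedContinuousFunction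

variable {X Y : Type*} [MeasurableSpace X] [MeasurableSpace Y]

/-- The law at time `n` of the random walk started at `y`. -/
noncomputable def lawAt (μ : Measure X) (F : X → Y → Y) (y : Y) : ℕ → Measure Y
  | 0 => Measure.dirac y
  | n + 1 => (μ.prod (lawAt μ F y n)).map (Function.uncurry F)

variable {μ : Measure X} [IsProbabilityMeasure μ] {F : X → Y → Y}

theorem isProbabilityMeasure_lawAt (hF : Measurable (Function.uncurry F)) (y : Y) (n : ℕ) :
    IsProbabilityMeasure (lawAt μ F y n) := by
  induction n with
  | zero => exact Measure.dirac.isProbabilityMeasure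
  | succ n ih => exact Measure.isProbabilityMeasure_map hF.aemeasurable

/-- Restriction to an invariant set preserves stationarity. -/
theorem map_prod_restrict {μ : Measure X} {η : Measure Y} [IsProbabilityMeasure η]
    (hF : Measurable (Function.uncurry F))
    (hη : (μ.prod η).map (Function.uncurry F) = η) {A : Set Y} (hA : MeasurableSet A)
    (hinv : ∀ᵐ a ∂μ, η (symmDiff (F a ⁻¹' A) A) = 0) :
    (μ.prod (η.restrict A)).map (Function.uncurry F) = η.restrict A := by
  ext B hB
  have hFa : ∀ a, Measurable (F a) := fun a => hF.comp measurable_prodMk_left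
  rw [Measure.map_apply hF hB, Measure.prod_apply (hF hB), Measure.restrict_apply hB]
  conv_rhs => rw [← hη, Measure.map_apply hF (hB.inter hA), Measure.prod_apply (hF (hB.inter hA))]
  refine lintegral_congr_ae ?_
  filter_upwards [hinv] with a ha
  rw [measure_symmDiff_eq_zero_iff] at ha
  refine (Measure.restrict_apply ((hFa a) hB)).trans (measure_congr ?_)
  exact (ae_eq_refl (F a ⁻¹' B)).inter ha.symm

variable [TopologicalSpace Y] [TopologicalSpace.MetrizableSpace Y]

/-- Averaging a jointly measurable bounded family of continuous functions. -/
theorem continuous_integral_param {φ : X → Y → ℝ} (hφ : Measurable (Function.uncurry φ))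
    (hφc : ∀ a, Continuous (φ a)) {B : ℝ} (hφb : ∀ᵐ a ∂μ, ∀ y, |φ a y| ≤ B) :
    Continuous fun y => ∫ a, φ a y ∂μ := by
  let _ := TopologicalSpace.metrizableSpaceMetric Y
  refine continuous_of_dominated (bound := fun _ => B) (fun y => ?_) (fun y => ?_)
    (integrable_const B) (.of_forall fun a => hφc a)
  · exact (hφ.comp measurable_prodMk_right).aestronglyMeasurable
  · filter_upwards [hφb] with a ha using ha y

variable [BorelSpace Y]

/-- The Feller property, through which stationarity is a closed condition in the weak topology. -/
theorem continuous_integral_comp (hF : Measurable (Function.uncurry F))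
    (hFc : ∀ a, Continuous (F a)) (g : Y →ᵇ ℝ) : Continuous fun y => ∫ a, g (F a y) ∂μ :=
  continuous_integral_param (φ := fun a y => g (F a y)) (B := ‖g‖)
    (g.continuous.measurable.comp hF) (fun a => g.continuous.comp (hFc a))
    (.of_forall fun _ _ => g.norm_coe_le_norm _)

omit [TopologicalSpace.MetrizableSpace Y] in
theorem integral_map_prod (hF : Measurable (Function.uncurry F)) (g : Y →ᵇ ℝ)
    (η : Measure Y) [IsProbabilityMeasure η] :
    ∫ y, g y ∂(μ.prod η).map (Function.uncurry F) = ∫ y, ∫ a, g (F a y) ∂μ ∂η := by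
  rw [integral_map hF.aemeasurable g.continuous.measurable.aestronglyMeasurable]
  exact integral_prod_symm _ (Integrable.of_bound
    (g.continuous.measurable.comp hF).aestronglyMeasurable ‖g‖
    (.of_forall fun p => g.norm_coe_le_norm _))

theorem stationary_iff (hF : Measurable (Function.uncurry F))
    (η : Measure Y) [IsProbabilityMeasure η] :
    (μ.prod η).map (Function.uncurry F) = η ↔
      ∀ g : Y →ᵇ ℝ, ∫ y, ∫ a, g (F a y) ∂μ ∂η = ∫ y, g y ∂η := by
  let _ := TopologicalSpace.metrizableSpaceMetric Y
  have := Measure.isProbabilityMeasure_map (μ := μ.prod η) hF.aemeasurable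
  refine ⟨fun h g => ?_, fun h => ?_⟩
  · rw [← integral_map_prod hF, h]
  · refine ext_of_forall_integral_eq_of_IsFiniteMeasure fun g => ?_
    rw [integral_map_prod hF, h]

variable [CompactSpace Y]

omit [TopologicalSpace.MetrizableSpace Y] in
theorem continuous_integral_probabilityMeasure {g : Y → ℝ} (hg : Continuous g) :
    Continuous fun η : ProbabilityMeasure Y => ∫ y, g y ∂(η : Measure Y) :=
  ProbabilityMeasure.continuous_integral_boundedContinuousFunction (mkOfCompact ⟨g, hg⟩)

theorem isClosed_stationary (hF : Measurable (Function.uncurry F))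
    (hFc : ∀ a, Continuous (F a)) :
    IsClosed {η : ProbabilityMeasure Y |
      (μ.prod (η : Measure Y)).map (Function.uncurry F) = (η : Measure Y)} := by
  simp only [stationary_iff hF, Set.ofPred_forall]
  exact isClosed_iInter fun g => isClosed_eq
    (continuous_integral_probabilityMeasure (continuous_integral_comp hF hFc g))
    (continuous_integral_probabilityMeasure g.continuous)

/-- The Krylov–Bogolyubov argument: average the laws over a long time and take a weak limit. The
hypothesis bounds the unnormalised sum of `ψ` by `1`, so normalisation leaves at most `0` in the
limit. -/
theorem exists_stationary_integral_nonpos (hF : Measurable (Function.uncurry F))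
    (hFc : ∀ a, Continuous (F a)) {ψ : Y → ℝ} (hψ : Continuous ψ)
    (h : ∀ N : ℕ, ∃ y, ∑ i ∈ Finset.range N, ∫ z, ψ z ∂(lawAt μ F y i) ≤ 1) :
    ∃ η : ProbabilityMeasure Y,
      (μ.prod (η : Measure Y)).map (Function.uncurry F) = (η : Measure Y) ∧
      ∫ y, ψ y ∂(η : Measure Y) ≤ 0 := by
  choose y hy using h
  have hprob := fun N i => isProbabilityMeasure_lawAt (μ := μ) hF (y N) i
  let m : ℕ → Measure Y := fun N =>
    ((N + 1 : ℕ) : ENNReal)⁻¹ • ∑ i ∈ Finset.range (N + 1), lawAt μ F (y (N + 1)) i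
  have hm : ∀ N, IsProbabilityMeasure (m N) := fun N => ⟨by
    simp only [m, Measure.smul_apply, Measure.finsetSum_apply, measure_univ, Finset.sum_const,
      Finset.card_range, smul_eq_mul, nsmul_eq_mul, mul_one]
    exact ENNReal.inv_mul_cancel (by simp) (ENNReal.natCast_ne_top _)⟩
  have hint : ∀ (g : Y → ℝ), Continuous g → ∀ N, ∫ z, g z ∂(m N) =
      ((N + 1 : ℕ) : ℝ)⁻¹ * ∑ i ∈ Finset.range (N + 1), ∫ z, g z ∂(lawAt μ F (y (N + 1)) i) := by
    intro g hg N
    have hi : ∀ i ∈ Finset.range (N + 1), Integrable g (lawAt μ F (y (N + 1)) i) := fun i _ => by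
      have := hprob (N + 1) i
      exact (mkOfCompact ⟨g, hg⟩).integrable _
    rw [integral_smul_measure, integral_finsetSum_measure hi,
      ENNReal.toReal_inv, ENNReal.toReal_natCast, smul_eq_mul]
  let η' : ℕ → ProbabilityMeasure Y := fun N => ⟨m N, hm N⟩
  -- A limit along a free ultrafilter exists by compactness alone, with no subsequence to extract.
  obtain ⟨η, -, hη⟩ := isCompact_univ.ultrafilter_le_nhds ((hyperfilter ℕ).map η') (by simp)
  have hlim : ∀ {g : Y → ℝ}, Continuous g → Tendsto (fun N => ∫ z, g z ∂(m N))
      (hyperfilter ℕ : Filter ℕ) (𝓝 (∫ z, g z ∂(η : Measure Y))) := fun hg =>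
    ((continuous_integral_probabilityMeasure hg).tendsto η).comp hη
  have hinf : (hyperfilter ℕ : Filter ℕ) ≤ atTop := by
    rw [← Nat.cofinite_eq_atTop]; exact hyperfilter_le_cofinite
  have hinv : Tendsto (fun N : ℕ => ((N + 1 : ℕ) : ℝ)⁻¹) (hyperfilter ℕ : Filter ℕ) (𝓝 0) :=
    ((tendsto_inv_atTop_nhds_zero_nat (𝕜 := ℝ)).comp (tendsto_add_atTop_nat 1)).mono_left hinf
  refine ⟨η, (stationary_iff hF _).2 fun g => ?_, ?_⟩
  · have h1 := (hlim (continuous_integral_comp (μ := μ) hF hFc g)).sub (hlim g.continuous)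
    have h2 : Tendsto (fun N : ℕ => ((N + 1 : ℕ) : ℝ)⁻¹ * (2 * ‖g‖)) (hyperfilter ℕ : Filter ℕ)
        (𝓝 0) := by simpa using hinv.mul_const (2 * ‖g‖)
    have hle : ∀ N, ‖∫ z, ∫ a, g (F a z) ∂μ ∂(m N) - ∫ z, g z ∂(m N)‖ ≤
        ((N + 1 : ℕ) : ℝ)⁻¹ * (2 * ‖g‖) := fun N => by
      rw [hint _ (continuous_integral_comp (μ := μ) hF hFc g), hint _ g.continuous, ← mul_sub,
        ← Finset.sum_sub_distrib, norm_mul, norm_inv, Real.norm_natCast]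
      gcongr
      have hstep : ∀ i, ∫ z, ∫ a, g (F a z) ∂μ ∂(lawAt μ F (y (N + 1)) i) =
          ∫ z, g z ∂(lawAt μ F (y (N + 1)) (i + 1)) := fun i => by
        have := hprob (N + 1) i
        exact (integral_map_prod hF g _).symm
      -- The defect of stationarity telescopes to its last and first terms, whence the bound `2 *
      -- ‖g‖` independent of `N`.
      simp only [hstep, Finset.sum_range_sub fun i => ∫ z, g z ∂(lawAt μ F (y (N + 1)) i)]
      have hb : ∀ i, ‖∫ z, g z ∂(lawAt μ F (y (N + 1)) i)‖ ≤ ‖g‖ := fun i => by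
        have := hprob (N + 1) i
        exact g.norm_integral_le_norm _
      refine (norm_sub_le _ _).trans ?_
      linarith [hb (N + 1), hb 0]
    exact sub_eq_zero.1 (tendsto_nhds_unique h1 (squeeze_zero_norm hle h2))
  · refine le_of_tendsto_of_tendsto' (hlim hψ) hinv fun N => ?_
    rw [hint ψ hψ]
    exact mul_le_of_le_one_right (by positivity) (hy (N + 1))

/-- Take an extreme point `η` of the set of stationary measures minimising `∫ ψ`. If `A` were
invariant with `0 < η A < 1`, then `η` conditioned on `A` and on `Aᶜ` would be stationary. Their
drifts are at least the minimum and average to it, so both are minimisers, and extremality forces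
`η` conditioned on `A` to be `η`. -/
theorem exists_ergodic_stationary (hF : Measurable (Function.uncurry F))
    (hFc : ∀ a, Continuous (F a)) {ψ : Y → ℝ} (hψ : Continuous ψ)
    (h : ∀ N : ℕ, ∃ y, ∑ i ∈ Finset.range N, ∫ z, ψ z ∂(lawAt μ F y i) ≤ 1) :
    ∃ η : Measure Y, IsProbabilityMeasure η ∧ (μ.prod η).map (Function.uncurry F) = η ∧
      ErgodicFor F μ η ∧ ∫ y, ψ y ∂η ≤ 0 := by
  let _ := TopologicalSpace.metrizableSpaceMetric Y
  obtain ⟨η₀, hη₀, hη₀le⟩ := exists_stationary_integral_nonpos (μ := μ) hF hFc hψ h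
  set S : Set (ProbabilityMeasure Y) := {η : ProbabilityMeasure Y |
      (μ.prod (η : Measure Y)).map (Function.uncurry F) = (η : Measure Y)} with hS
  have hScomp : IsCompact S := (isClosed_stationary hF hFc).isCompact
  have hψc := continuous_integral_probabilityMeasure hψ
  obtain ⟨η₁, hη₁, hmin⟩ := hScomp.exists_isMinOn ⟨η₀, hη₀⟩ hψc.continuousOn
  set c := ∫ y, ψ y ∂(η₁ : Measure Y) with hc
  have hmin' : ∀ η ∈ S, c ≤ ∫ y, ψ y ∂(η : Measure Y) := fun η hη => hmin hη
  set S' : Set (ProbabilityMeasure Y) := S ∩ {η | ∫ y, ψ y ∂(η : Measure Y) = c} with hS'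
  have hS'comp : IsCompact S' := hScomp.inter_right (isClosed_eq hψc continuous_const)
  -- Extreme points require an ambient vector space, so measures are replaced by their integration
  -- functionals.
  let Λ : ProbabilityMeasure Y → ((Y →ᵇ ℝ) → ℝ) := fun η g => ∫ y, g y ∂(η : Measure Y)
  have hΛ : Continuous Λ :=
    continuous_pi fun g => continuous_integral_probabilityMeasure g.continuous
  obtain ⟨-, ⟨η, hη, rfl⟩, hext⟩ :=
    (hS'comp.image hΛ).extremePoints_nonempty (Set.Nonempty.image Λ ⟨η₁, hη₁, rfl⟩)
  refine ⟨η, inferInstance, hη.1, fun A hA hinv => ?_, ?_⟩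
  · by_contra! hne
    have h0 : (η : Measure Y) A ≠ 0 := hne.1
    have h0c : (η : Measure Y) Aᶜ ≠ 0 := fun h' => hne.2 ((prob_compl_eq_zero_iff hA).1 h')
    have hstat : ∀ {A : Set Y}, MeasurableSet A →
        (∀ᵐ a ∂μ, (η : Measure Y) (symmDiff (F a ⁻¹' A) A) = 0) →
        (μ.prod (ProbabilityTheory.cond (η : Measure Y) A)).map (Function.uncurry F) =
          ProbabilityTheory.cond (η : Measure Y) A := fun hA hinv => by
      rw [ProbabilityTheory.cond, Measure.prod_smul_right, Measure.map_smul,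
        map_prod_restrict hF hη.1 hA hinv]
    have hinvc : ∀ᵐ a ∂μ, (η : Measure Y) (symmDiff (F a ⁻¹' Aᶜ) Aᶜ) = 0 := by
      filter_upwards [hinv] with a ha
      rwa [Set.preimage_compl, compl_symmDiff_compl]
    have p1 := ProbabilityTheory.cond_isProbabilityMeasure h0
    have p2 := ProbabilityTheory.cond_isProbabilityMeasure h0c
    let η1 : ProbabilityMeasure Y := ⟨ProbabilityTheory.cond (η : Measure Y) A, p1⟩
    let η2 : ProbabilityMeasure Y := ⟨ProbabilityTheory.cond (η : Measure Y) Aᶜ, p2⟩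
    have hη1 : η1 ∈ S := hstat hA hinv
    have hη2 : η2 ∈ S := hstat hA.compl hinvc
    set p := (η : Measure Y).real A with hp
    have hp0 : 0 < p := ENNReal.toReal_pos h0 (measure_ne_top _ _)
    have hpc : (η : Measure Y).real Aᶜ = 1 - p := probReal_compl_eq_one_sub hA
    have hp1 : 0 < 1 - p := hpc ▸ ENNReal.toReal_pos h0c (measure_ne_top _ _)
    have hsplit : ∀ g : Y → ℝ, Continuous g → ∫ y, g y ∂(η : Measure Y) =
        p * ∫ y, g y ∂(η1 : Measure Y) + (1 - p) * ∫ y, g y ∂(η2 : Measure Y) := by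
      intro g hg
      have hi : Integrable g (η : Measure Y) := (mkOfCompact ⟨g, hg⟩).integrable _
      have e : ∀ {A : Set Y}, (η : Measure Y) A ≠ 0 → (η : Measure Y).real A *
          ∫ y, g y ∂(ProbabilityTheory.cond (η : Measure Y) A) = ∫ y in A, g y ∂(η : Measure Y) := by
        intro A hA0
        rw [ProbabilityTheory.cond, integral_smul_measure, ENNReal.toReal_inv, smul_eq_mul,
          ← mul_assoc, Measure.real, mul_inv_cancel₀, one_mul]
        exact (ENNReal.toReal_pos hA0 (measure_ne_top _ _)).ne'
      rw [← hpc]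
      exact (integral_add_compl hA hi).symm.trans (by rw [← e h0, ← e h0c]; rfl)
    have hsψ := hsplit ψ hψ
    rw [hη.2] at hsψ
    have m1 := hmin' η1 hη1
    have m2 := hmin' η2 hη2
    have e1 : ∫ y, ψ y ∂(η1 : Measure Y) = c := by nlinarith
    have e2 : ∫ y, ψ y ∂(η2 : Measure Y) = c := by nlinarith
    have heq : Λ η1 = Λ η := hext ⟨η1, ⟨hη1, e1⟩, rfl⟩ ⟨η2, ⟨hη2, e2⟩, rfl⟩
      ⟨p, 1 - p, hp0, hp1, by ring, funext fun g => (hsplit g g.continuous).symm⟩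
    have hμ : (η1 : Measure Y) = η :=
      ext_of_forall_integral_eq_of_IsFiniteMeasure fun g => congrFun heq g
    refine hne.2 ?_
    rw [← hμ]
    exact ProbabilityTheory.cond_apply_self h0 (measure_ne_top _ _)
  · rw [hη.2]
    exact (hmin' η₀ hη₀).trans hη₀le

/-- A random walk on a compact space with a continuous additive cocycle whose expectations along
the walk do not grow has an ergodic stationary measure whose drift is non-positive. -/
theorem exists_ergodic_stationary_tendsto_nonpos (hF : Measurable (Function.uncurry F))
    (hFc : ∀ a, Continuous (F a)) {φ : X → Y → ℝ} (hφ : Measurable (Function.uncurry φ))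
    (hφc : ∀ a, Continuous (φ a)) {B : ℝ} (hφb : ∀ᵐ a ∂μ, ∀ y, |φ a y| ≤ B)
    (h : ∀ N : ℕ, ∃ y, ∑ i ∈ Finset.range N, ∫ z, ∫ a, φ a z ∂μ ∂(lawAt μ F y i) ≤ 1) :
    ∃ η : Measure Y, IsProbabilityMeasure η ∧ (μ.prod η).map (Function.uncurry F) = η ∧
      ErgodicFor F μ η ∧ ∃ χ ≤ 0, ∀ᵐ p ∂((iidMeasure μ).prod η),
        Tendsto (fun n : ℕ => (1 / (n : ℝ)) *
          birkhoffSum (skew F) (fun p => φ (p.1 0) p.2) n p) atTop (𝓝 χ) := by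
  obtain ⟨η, hη, hst, he, hle⟩ := exists_ergodic_stationary (μ := μ) hF hFc
    (continuous_integral_param hφ hφc hφb) h
  refine ⟨η, hη, hst, he, _, hle, ?_⟩
  have hmp : MeasurePreserving (Prod.map (Function.eval 0) id : (ℕ → X) × Y → X × Y)
      ((iidMeasure μ).prod η) (μ.prod η) :=
    (measurePreserving_eval_infinitePi (fun _ : ℕ => μ) 0).prod (MeasurePreserving.id η)
  have hae : ∀ᵐ p ∂(μ.prod η), ‖Function.uncurry φ p‖ ≤ B := by
    have : ∀ᵐ p ∂(μ.prod η), ∀ y, |φ p.1 y| ≤ B :=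
      Measure.quasiMeasurePreserving_fst.ae hφb
    filter_upwards [this] with p hp using hp p.2
  have hint : Integrable (Function.uncurry φ) (μ.prod η) :=
    Integrable.of_bound hφ.aestronglyMeasurable B hae
  have := ae_tendsto_birkhoffAverage (ergodic_skew hF hst he)
    (h := fun p : (ℕ → X) × Y => φ (p.1 0) p.2) (hφ.comp hmp.measurable)
    (hmp.integrable_comp_of_integrable hint)
  -- The Birkhoff limit depends only on the first coordinate and `Y`, so it is the `η`-mean of the
  -- drift.
  have e : ∫ p, φ (p.1 0) p.2 ∂((iidMeasure μ).prod η) = ∫ y, ∫ a, φ a y ∂μ ∂η := by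
    refine Eq.trans ?_ (integral_prod_symm _ hint)
    conv_rhs => rw [← hmp.map_eq]
    rw [integral_map hmp.measurable.aemeasurable hφ.aestronglyMeasurable]
    rfl
  rwa [e] at this

end StationaryMeasures

/-! ### Topology of the Grassmann bundle. -/

section GrassmannTopology

variable {d k : ℕ} {M : Type*} [TopologicalSpace M] [ChartedSpace (EuclideanSpace ℝ (Fin d)) M]

theorem GrassmannBundle.mk_congr {x : M} {V W : Submodule ℝ (TangentSpace (𝓡 d) x)} (h : V = W)
    (hV : Module.finrank ℝ V = k) (hW : Module.finrank ℝ W = k) :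
    (⟨x, V, hV⟩ : GrassmannBundle d k M) = ⟨x, W, hW⟩ := by
  subst h; rfl

theorem GrassmannBundle.toGrassmann_surjective :
    Function.Surjective (TangentFrame.toGrassmann : TangentFrame d k M → GrassmannBundle d k M) := by
  rintro ⟨x, V, hV⟩
  have : FiniteDimensional ℝ V := inferInstance
  let b := Module.finBasisOfFinrankEq ℝ V hV
  refine ⟨⟨x, fun i => (b i : TangentSpace (𝓡 d) x),
    b.linearIndependent.map' V.subtype V.ker_subtype⟩, ?_⟩
  simp only [TangentFrame.toGrassmann, GrassmannBundle.mk.injEq, true_and]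
  have h := congrArg (Submodule.map V.subtype) b.span_eq
  rw [Submodule.map_span, Submodule.map_top, Submodule.range_subtype, ← Set.range_comp] at h
  exact h

theorem linearIndependent_mfderiv [IsManifold (𝓡 d) ∞ M] (f : Diff d M) {x : M}
    {v : Fin k → TangentSpace (𝓡 d) x} (hv : LinearIndependent ℝ v) :
    LinearIndependent ℝ fun i => mfderiv (𝓡 d) (𝓡 d) f x (v i) :=
  hv.map' (mfderiv (𝓡 d) (𝓡 d) f x).toLinearMap
    (LinearMap.ker_eq_bot.2 (f.mfderivToContinuousLinearEquiv (x := x) (by simp)).injective)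

variable [IsManifold (𝓡 d) ∞ M]

/-- The action of a diffeomorphism on frames. -/
noncomputable def frameMap (f : Diff d M) (e : TangentFrame d k M) : TangentFrame d k M where
  base := f e.base
  vec i := mfderiv (𝓡 d) (𝓡 d) f e.base (e.vec i)
  linearIndependent := linearIndependent_mfderiv f e.linearIndependent

theorem grassmannMap_toGrassmann (f : Diff d M) (e : TangentFrame d k M) :
    grassmannMap f e.toGrassmann = (frameMap f e).toGrassmann := by
  refine GrassmannBundle.mk_congr ?_ _ _
  refine (Submodule.map_span (mfderiv (𝓡 d) (𝓡 d) f e.base).toLinearMap (Set.range e.vec)).trans ?_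
  rw [← Set.range_comp]
  rfl

theorem continuous_frame_iff {Z : Type*} [TopologicalSpace Z] {g : Z → TangentFrame d k M} :
    Continuous g ↔ Continuous (fun z => (g z).base) ∧
      ∀ i, Continuous fun z => (⟨(g z).base, (g z).vec i⟩ : TangentBundle (𝓡 d) M) := by
  rw [continuous_induced_rng]
  simp only [Function.comp_def, continuous_prodMk, continuous_pi_iff]

theorem continuous_frame_base : Continuous fun e : TangentFrame d k M => e.base :=
  (continuous_frame_iff.1 continuous_id).1

theorem continuous_frame_vec (i : Fin k) :
    Continuous fun e : TangentFrame d k M => (⟨e.base, e.vec i⟩ : TangentBundle (𝓡 d) M) :=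
  (continuous_frame_iff.1 continuous_id).2 i

theorem continuous_toGrassmann :
    Continuous (TangentFrame.toGrassmann : TangentFrame d k M → GrassmannBundle d k M) :=
  continuous_coinduced_rng

theorem continuous_grassmann_iff {Z : Type*} [TopologicalSpace Z] {g : GrassmannBundle d k M → Z} :
    Continuous g ↔ Continuous fun e : TangentFrame d k M => g e.toGrassmann :=
  continuous_coinduced_dom

theorem continuous_frameMap (f : Diff d M) :
    Continuous (frameMap f : TangentFrame d k M → TangentFrame d k M) := by
  refine continuous_frame_iff.2 ⟨f.continuous.comp continuous_frame_base, fun i => ?_⟩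
  have h : Continuous (tangentMap (𝓡 d) (𝓡 d) f) :=
    f.contMDiff.continuous_tangentMap (by simp)
  exact h.comp (continuous_frame_vec i)

theorem continuous_grassmannMap (f : Diff d M) :
    Continuous (grassmannMap f : GrassmannBundle d k M → GrassmannBundle d k M) := by
  refine continuous_grassmann_iff.2 ?_
  simp only [grassmannMap_toGrassmann]
  exact continuous_toGrassmann.comp (continuous_frameMap f)

instance : BorelSpace (GrassmannBundle d k M) := ⟨rfl⟩

theorem isCompact_orthonormal {E : Type*} [NormedAddCommGroup E] [InnerProductSpace ℝ E]
    [FiniteDimensional ℝ E] : IsCompact {u : Fin k → E | Orthonormal ℝ u} := by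
  refine Metric.isCompact_of_isClosed_isBounded ?_ ?_
  · have : {u : Fin k → E | Orthonormal ℝ u} =
        ⋂ i, ⋂ j, {u | inner ℝ (u i) (u j) = if i = j then (1 : ℝ) else 0} := by
      ext u
      simp [orthonormal_iff_ite]
    rw [this]
    exact isClosed_iInter fun i => isClosed_iInter fun j =>
      isClosed_eq (by fun_prop) continuous_const
  · refine (Metric.isBounded_closedBall (x := 0) (r := 1)).subset fun u hu => ?_
    rw [mem_closedBall_zero_iff, pi_norm_le_iff_of_nonneg zero_le_one]
    exact fun i => (hu.1 i).le

/-- The planes over a compact set contained in a trivialization domain form a compact set. -/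
theorem exists_isCompact_superset_of_trivialization (x₀ : M) {K : Set M} (hK : IsCompact K)
    (hKx : K ⊆ (trivializationAt (EuclideanSpace ℝ (Fin d)) (TangentSpace (𝓡 d)) x₀).baseSet) :
    ∃ C : Set (GrassmannBundle d k M), IsCompact C ∧ {ξ | ξ.base ∈ K} ⊆ C := by
  set e := trivializationAt (EuclideanSpace ℝ (Fin d)) (TangentSpace (𝓡 d)) x₀ with he
  let O := {u : Fin k → EuclideanSpace ℝ (Fin d) | Orthonormal ℝ u}
  have : CompactSpace K := isCompact_iff_compactSpace.1 hK
  have : CompactSpace O := isCompact_iff_compactSpace.1 isCompact_orthonormal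
  let L : ∀ y : K, TangentSpace (𝓡 d) y.1 ≃L[ℝ] EuclideanSpace ℝ (Fin d) := fun y =>
    e.continuousLinearEquivAt ℝ y.1 (hKx y.2)
  -- Orthonormality is imposed in the trivialization, where frames form a fixed compact set; every
  -- plane over `K` is spanned by such a frame.
  let Ψ : K × O → TangentFrame d k M := fun p =>
    { base := p.1.1
      vec := fun i => (L p.1).symm (p.2.1 i)
      linearIndependent := p.2.2.linearIndependent.map' (L p.1).symm.toLinearEquiv.toLinearMap
        (LinearMap.ker_eq_bot.2 (L p.1).symm.injective) }
  have hΨ : Continuous Ψ := by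
    refine continuous_frame_iff.2 ⟨continuous_subtype_val.comp continuous_fst, fun i => ?_⟩
    have h1 : Continuous fun p : K × O => (p.1.1, p.2.1 i) :=
      (continuous_subtype_val.comp continuous_fst).prodMk
        ((continuous_apply i).comp (continuous_subtype_val.comp continuous_snd))
    have h2 := e.toOpenPartialHomeomorph.continuousOn_symm.comp_continuous h1 fun p => by
      exact e.mem_target.2 (hKx p.1.2)
    refine h2.congr fun p => ?_
    exact e.symm_apply_eq_mk_continuousLinearEquivAt_symm (R := ℝ) p.1.1 (hKx p.1.2) (p.2.1 i)
  refine ⟨Set.range (TangentFrame.toGrassmann ∘ Ψ),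
    isCompact_range (continuous_toGrassmann.comp hΨ), ?_⟩
  rintro ⟨x, V, hV⟩ hx
  let y : K := ⟨x, hx⟩
  let W := V.map (L y).toLinearEquiv.toLinearMap
  have hW : Module.finrank ℝ W = k := ((L y).toLinearEquiv.finrank_map_eq V).trans hV
  let b := (stdOrthonormalBasis ℝ W).reindex (finCongr hW)
  have hb : Orthonormal ℝ fun i => (b i : EuclideanSpace ℝ (Fin d)) :=
    b.orthonormal.comp_linearIsometry W.subtypeₗᵢ
  refine ⟨(y, ⟨_, hb⟩), ?_⟩
  simp only [Function.comp_apply, TangentFrame.toGrassmann, GrassmannBundle.mk.injEq, Ψ, true_and, y]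
  have h := congrArg (Submodule.map W.subtype) b.toBasis.span_eq
  rw [Submodule.map_span, Submodule.map_top, Submodule.range_subtype, ← Set.range_comp] at h
  have h2 := congrArg (Submodule.map (L y).symm.toLinearEquiv.toLinearMap) h
  rw [Submodule.map_span, ← Set.range_comp] at h2
  convert h2 using 2
  · ext i; simp [Function.comp_def, y]
  · simp only [W]
    rw [← Submodule.map_comp]
    convert (Submodule.map_id V).symm
    ext v
    simp

theorem compactSpace_grassmannBundle [CompactSpace M] [T2Space M] :
    CompactSpace (GrassmannBundle d k M) := by
  have h : ∀ x : M, ∃ K ∈ 𝓝 x, ∃ C : Set (GrassmannBundle d k M), IsCompact C ∧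
      {ξ | ξ.base ∈ K} ⊆ C := fun x => by
    obtain ⟨K, hK, hKs, hKc⟩ := LocallyCompactSpace.local_compact_nhds x _
      ((trivializationAt (EuclideanSpace ℝ (Fin d)) (TangentSpace (𝓡 d)) x).open_baseSet.mem_nhds
        (FiberBundle.mem_baseSet_trivializationAt' x))
    exact ⟨K, hK, exists_isCompact_superset_of_trivialization x hKc hKs⟩
  choose K hK C hC hKC using h
  obtain ⟨t, -, ht⟩ := isCompact_univ.elim_nhds_subcover K fun x _ => hK x
  refine ⟨(t.isCompact_biUnion fun x _ => hC x).of_isClosed_subset isClosed_univ fun ξ _ => ?_⟩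
  obtain ⟨x, hx, hξ⟩ := Set.mem_iUnion₂.1 (ht (Set.mem_univ ξ.base))
  exact Set.mem_iUnion₂.2 ⟨x, hx, hKC x hξ⟩

end GrassmannTopology

/-! ### Continuity of the volume of a family of vectors. -/

section Wedge

variable {E : Type*} [NormedAddCommGroup E] [InnerProductSpace ℝ E] [FiniteDimensional ℝ E] {k : ℕ}

theorem continuous_norm_ιMulti :
    Continuous fun v : Fin k → E => ‖exteriorPower.ιMulti ℝ k v‖ := by
  simp only [norm_ιMulti]
  refine Real.continuous_sqrt.comp (Continuous.matrix_det ?_)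
  refine continuous_matrix fun i j => ?_
  simp only [Matrix.gram_apply]
  exact (continuous_apply i).inner (continuous_apply j)

end Wedge

theorem metrizableSpace_and_secondCountable (d : ℕ) (M : Type*) [TopologicalSpace M]
    [ChartedSpace (EuclideanSpace ℝ (Fin d)) M] [IsManifold (𝓡 d) ∞ M]
    [CompactSpace M] [T2Space M] :
    TopologicalSpace.MetrizableSpace M ∧ SecondCountableTopology M := by
  obtain ⟨n, e, -, he, -⟩ := exists_embedding_euclidean_of_compact (I := 𝓡 d) (M := M)
  exact ⟨he.isEmbedding.metrizableSpace, he.isEmbedding.secondCountableTopology⟩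

theorem measurable_eval {d : ℕ} {M : Type*} [TopologicalSpace M]
    [ChartedSpace (EuclideanSpace ℝ (Fin d)) M] [MeasurableSpace M] (x : M) : Measurable fun f : Diff d M => f x := by
  rw [measurable_iff_comap_le]
  exact le_iSup (fun x : M => MeasurableSpace.comap (fun f : Diff d M => f x) inferInstance) x

/-! ### Metrizability through a Euclidean embedding. -/

section EuclideanEmbedding

variable {d k n : ℕ} {M : Type*} [TopologicalSpace M] [ChartedSpace (EuclideanSpace ℝ (Fin d)) M]

/-- The derivative of a map to a Euclidean space. -/
noncomputable def euclidDeriv (h : M → EuclideanSpace ℝ (Fin n)) (x : M) :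
    TangentSpace (𝓡 d) x →ₗ[ℝ] EuclideanSpace ℝ (Fin n) :=
  (mfderiv (𝓡 d) 𝓘(ℝ, EuclideanSpace ℝ (Fin n)) h x).toLinearMap

/-- This writes a derivative as a limit of expressions in countably many point values, which makes
it measurable for a σ-algebra generated by evaluations. -/
theorem tendsto_euclidDeriv {h : M → EuclideanSpace ℝ (Fin n)} {x : M}
    (hh : MDifferentiableAt (𝓡 d) 𝓘(ℝ, EuclideanSpace ℝ (Fin n)) h x)
    (v : EuclideanSpace ℝ (Fin d)) :
    Tendsto (fun m : ℕ => (m : ℝ) • (h ((extChartAt (𝓡 d) x).symm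
      (extChartAt (𝓡 d) x x + (m : ℝ)⁻¹ • v)) - h x))
      atTop (𝓝 (euclidDeriv h x v)) := by
  let L : EuclideanSpace ℝ (Fin d) →L[ℝ] EuclideanSpace ℝ (Fin n) :=
    mfderiv (𝓡 d) 𝓘(ℝ, EuclideanSpace ℝ (Fin n)) h x
  have h1 : HasFDerivAt (h ∘ (extChartAt (𝓡 d) x).symm) L (extChartAt (𝓡 d) x x) := by
    have : HasFDerivWithinAt (h ∘ (extChartAt (𝓡 d) x).symm) L (Set.range (𝓡 d))
      (extChartAt (𝓡 d) x x) := hh.hasMFDerivAt.2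
    rwa [modelWithCornersSelf_coe, Set.range_id, hasFDerivWithinAt_univ] at this
  have h2 := h1.lim v (c := fun m : ℕ => (m : ℝ)) (l := atTop)
    (by simpa using tendsto_natCast_atTop_atTop)
  simp only [Function.comp_apply, extChartAt_to_inv] at h2
  exact h2

/-- The image of a frame under the derivative of a map to a Euclidean space. -/
noncomputable def euclidFrame (h : M → EuclideanSpace ℝ (Fin n)) (e : TangentFrame d k M)
    (i : Fin k) : EuclideanSpace ℝ (Fin n) :=
  euclidDeriv h e.base (e.vec i)

theorem linearIndependent_euclidFrame
    {h : M → EuclideanSpace ℝ (Fin n)}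
    (hinj : ∀ x, Function.Injective (mfderiv (𝓡 d) 𝓘(ℝ, EuclideanSpace ℝ (Fin n)) h x))
    (e : TangentFrame d k M) : LinearIndependent ℝ (euclidFrame h e) :=
  e.linearIndependent.map' (euclidDeriv h e.base) (LinearMap.ker_eq_bot.2 (hinj e.base))

variable [IsManifold (𝓡 d) ∞ M]

theorem continuous_euclidFrame {h : M → EuclideanSpace ℝ (Fin n)}
    (hh : ContMDiff (𝓡 d) 𝓘(ℝ, EuclideanSpace ℝ (Fin n)) ∞ h) :
    Continuous (euclidFrame h : TangentFrame d k M → _) := by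
  refine continuous_pi fun i => ?_
  have h1 : Continuous (tangentMap (𝓡 d) 𝓘(ℝ, EuclideanSpace ℝ (Fin n)) h) :=
    hh.continuous_tangentMap (by simp)
  have h2 := (contMDiff_snd_tangentBundle_modelSpace (n := ∞) (EuclideanSpace ℝ (Fin n))
    𝓘(ℝ, EuclideanSpace ℝ (Fin n))).continuous
  exact h2.comp (h1.comp (continuous_frame_vec i))

theorem euclidFrame_frameMap {h : M → EuclideanSpace ℝ (Fin n)}
    (hh : ContMDiff (𝓡 d) 𝓘(ℝ, EuclideanSpace ℝ (Fin n)) ∞ h) (f : Diff d M)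
    (e : TangentFrame d k M) : euclidFrame h (frameMap f e) = euclidFrame (h ∘ f) e := by
  ext1 i
  have := mfderiv_comp e.base (hh.mdifferentiableAt (x := f e.base) (by simp))
    (f.contMDiff.mdifferentiableAt (x := e.base) (by simp))
  exact (congrArg (fun L => L (e.vec i)) this).symm

variable {h : M → EuclideanSpace ℝ (Fin n)}

/-- The distance from `u` to the image of a tangent plane in the Euclidean space. -/
noncomputable def planeDist (h : M → EuclideanSpace ℝ (Fin n)) (u : EuclideanSpace ℝ (Fin n))
    (ξ : GrassmannBundle d k M) : ℝ :=
  ‖u - (ξ.plane.map (euclidDeriv h ξ.base)).starProjection u‖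

omit [IsManifold (𝓡 d) ∞ M] in
-- A ratio of volumes is visibly continuous in the frame, unlike an orthogonal projection onto a
-- moving plane.
theorem planeDist_toGrassmann
    (hinj : ∀ x, Function.Injective (mfderiv (𝓡 d) 𝓘(ℝ, EuclideanSpace ℝ (Fin n)) h x))
    (u : EuclideanSpace ℝ (Fin n)) (e : TangentFrame d k M) :
    planeDist h u e.toGrassmann =
      ‖exteriorPower.ιMulti ℝ (k + 1) (Fin.cons u (euclidFrame h e) :
        Fin (k + 1) → EuclideanSpace ℝ (Fin n))‖ / ‖exteriorPower.ιMulti ℝ k (euclidFrame h e)‖ := by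
  rw [norm_ιMulti_cons, mul_div_cancel_right₀ _
    (norm_ιMulti_pos (linearIndependent_euclidFrame hinj e)).ne', planeDist]
  congr 4
  exact (Submodule.map_span (euclidDeriv h e.base) (Set.range e.vec)).trans
    (by rw [← Set.range_comp]; rfl)

/-- The Plücker-type embedding of the Grassmann bundle. -/
noncomputable def grassmannEmb (h : M → EuclideanSpace ℝ (Fin n)) (ξ : GrassmannBundle d k M) :
    M × (ℕ → ℝ) :=
  (ξ.base, fun m => planeDist h (TopologicalSpace.denseSeq (EuclideanSpace ℝ (Fin n)) m) ξ)

theorem continuous_wedgeRatio (u : EuclideanSpace ℝ (Fin n)) {Z : Type*} [TopologicalSpace Z]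
    {a : Z → Fin k → EuclideanSpace ℝ (Fin n)} (ha : Continuous a)
    (hli : ∀ z, LinearIndependent ℝ (a z)) :
    Continuous fun z => ‖exteriorPower.ιMulti ℝ (k + 1) (Fin.cons u (a z) :
        Fin (k + 1) → EuclideanSpace ℝ (Fin n))‖ / ‖exteriorPower.ιMulti ℝ k (a z)‖ := by
  refine Continuous.div ?_ (continuous_norm_ιMulti.comp ha) fun z => (norm_ιMulti_pos (hli z)).ne'
  exact continuous_norm_ιMulti.comp (continuous_const.finCons ha)

theorem continuous_grassmannEmb (hh : ContMDiff (𝓡 d) 𝓘(ℝ, EuclideanSpace ℝ (Fin n)) ∞ h)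
    (hinj : ∀ x, Function.Injective (mfderiv (𝓡 d) 𝓘(ℝ, EuclideanSpace ℝ (Fin n)) h x)) :
    Continuous (grassmannEmb h : GrassmannBundle d k M → _) := by
  refine continuous_grassmann_iff.2 (continuous_frame_base.prodMk (continuous_pi fun m => ?_))
  simp only [planeDist_toGrassmann hinj]
  exact continuous_wedgeRatio _ (continuous_euclidFrame hh) (linearIndependent_euclidFrame hinj)

omit [IsManifold (𝓡 d) ∞ M] in
-- The distances from a dense set of points to a subspace determine its distance function, whose
-- zero set is the subspace; injectivity of the derivative of `h` then recovers the plane.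
theorem injective_grassmannEmb
    (hinj : ∀ x, Function.Injective (mfderiv (𝓡 d) 𝓘(ℝ, EuclideanSpace ℝ (Fin n)) h x)) :
    Function.Injective (grassmannEmb h : GrassmannBundle d k M → _) := by
  rintro ⟨x, V, hV⟩ ⟨y, W, hW⟩ heq
  obtain rfl : x = y := congrArg Prod.fst heq
  have h1 : ∀ u, ‖u - (V.map (euclidDeriv h x)).starProjection u‖ =
      ‖u - (W.map (euclidDeriv h x)).starProjection u‖ := by
    have hc : ∀ K : Submodule ℝ (EuclideanSpace ℝ (Fin n)), Continuous fun u =>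
        ‖u - K.starProjection u‖ := fun K => by fun_prop
    exact congrFun (((TopologicalSpace.denseRange_denseSeq
      (EuclideanSpace ℝ (Fin n))).equalizer (hc _) (hc _) (congrArg Prod.snd heq)))
  refine GrassmannBundle.mk_congr ?_ _ _
  refine Submodule.map_injective_of_injective (f := euclidDeriv h x) (hinj x) ?_
  ext u
  rw [← Submodule.starProjection_eq_self_iff, ← Submodule.starProjection_eq_self_iff, eq_comm,
    ← sub_eq_zero, ← norm_eq_zero, h1, norm_eq_zero, sub_eq_zero, eq_comm]

/-- A continuous injection from a compact space to a Hausdorff one is a closed embedding, so the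
quotient topology inherits metrizability and second countability from `M × (ℕ → ℝ)`. -/
theorem isClosedEmbedding_grassmannEmb [CompactSpace M] [T2Space M]
    (hh : ContMDiff (𝓡 d) 𝓘(ℝ, EuclideanSpace ℝ (Fin n)) ∞ h)
    (hinj : ∀ x, Function.Injective (mfderiv (𝓡 d) 𝓘(ℝ, EuclideanSpace ℝ (Fin n)) h x)) :
    IsClosedEmbedding (grassmannEmb h : GrassmannBundle d k M → _) :=
  have := compactSpace_grassmannBundle (d := d) (k := k) (M := M)
  (continuous_grassmannEmb hh hinj).isClosedEmbedding (injective_grassmannEmb hinj)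

variable (d k M) in
theorem metrizableSpace_grassmannBundle [CompactSpace M] [T2Space M] :
    TopologicalSpace.MetrizableSpace (GrassmannBundle d k M) := by
  obtain ⟨n, e, he, -, hinj⟩ := exists_embedding_euclidean_of_compact (I := 𝓡 d) (M := M)
  have := (metrizableSpace_and_secondCountable d M).1
  exact (isClosedEmbedding_grassmannEmb he hinj).isEmbedding.metrizableSpace

variable (d k M) in
theorem secondCountable_grassmannBundle [CompactSpace M] [T2Space M] :
    SecondCountableTopology (GrassmannBundle d k M) := by
  obtain ⟨n, e, he, -, hinj⟩ := exists_embedding_euclidean_of_compact (I := 𝓡 d) (M := M)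
  have := (metrizableSpace_and_secondCountable d M).2
  exact (isClosedEmbedding_grassmannEmb he hinj).isEmbedding.secondCountableTopology

/-! ### Measurability of the action for the evaluation σ-algebra. -/

section Measurability

variable [CompactSpace M] [T2Space M] [MeasurableSpace M] [BorelSpace M]

omit [CompactSpace M] [T2Space M] in
theorem measurable_euclidFrame (hh : ContMDiff (𝓡 d) 𝓘(ℝ, EuclideanSpace ℝ (Fin n)) ∞ h)
    (e : TangentFrame d k M) : Measurable fun f : Diff d M => euclidFrame h (frameMap f e) := by
  simp only [euclidFrame_frameMap hh]
  refine measurable_pi_lambda _ fun i => ?_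
  refine measurable_of_tendsto_metrizable (f := fun (m : ℕ) (f : Diff d M) =>
    (m : ℝ) • ((h ∘ f) ((extChartAt (𝓡 d) e.base).symm (extChartAt (𝓡 d) e.base e.base +
      (m : ℝ)⁻¹ • (show EuclideanSpace ℝ (Fin d) from e.vec i))) - (h ∘ f) e.base)) (fun m => ?_)
    (tendsto_pi_nhds.2 fun f => ?_)
  · have hm : ∀ y : M, Measurable fun f : Diff d M => (h ∘ f) y := fun y =>
      hh.continuous.measurable.comp (measurable_eval y)
    exact ((hm _).sub (hm _)).const_smul (m : ℝ)
  · exact tendsto_euclidDeriv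
      ((hh.comp f.contMDiff).mdifferentiableAt (x := e.base) (by simp)) (e.vec i)

theorem measurable_grassmannMap_left (ξ : GrassmannBundle d k M) :
    Measurable fun f : Diff d M => grassmannMap f ξ := by
  obtain ⟨n, h, hh, -, hinj⟩ := exists_embedding_euclidean_of_compact (I := 𝓡 d) (M := M)
  have := (metrizableSpace_and_secondCountable d M).2
  obtain ⟨e, rfl⟩ := GrassmannBundle.toGrassmann_surjective ξ
  refine (isClosedEmbedding_grassmannEmb hh hinj).measurableEmbedding.measurable_comp_iff.1 ?_
  refine (measurable_eval e.base).prodMk (measurable_pi_lambda _ fun m => ?_)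
  simp only [grassmannMap_toGrassmann, planeDist_toGrassmann hinj]
  have hm := measurable_euclidFrame hh e
  refine Measurable.div ?_ (continuous_norm_ιMulti.measurable.comp hm)
  exact (continuous_norm_ιMulti.comp (continuous_const.finCons continuous_id)).measurable.comp hm

/-- A Carathéodory argument: continuity in the plane and measurability in the diffeomorphism give
joint measurability. -/
theorem measurable_grassmannMap :
    Measurable fun p : Diff d M × GrassmannBundle d k M => grassmannMap p.1 p.2 := by
  have := metrizableSpace_grassmannBundle d k M
  have := secondCountable_grassmannBundle d k M
  exact (measurable_uncurry_of_continuous_of_measurable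
    (u := fun (ξ : GrassmannBundle d k M) (f : Diff d M) => grassmannMap f ξ)
    continuous_grassmannMap measurable_grassmannMap_left).comp measurable_swap

theorem measurable_trans :
    Measurable fun p : Diff d M × Diff d M => p.2.trans p.1 := by
  have := (metrizableSpace_and_secondCountable d M).1
  have := (metrizableSpace_and_secondCountable d M).2
  refine measurable_iff_comap_le.2 ?_
  rw [instMeasurableSpaceDiff, MeasurableSpace.comap_iSup]
  refine iSup_le fun x => ?_
  rw [MeasurableSpace.comap_comp, ← measurable_iff_comap_le]
  have h1 : Measurable fun p : M × Diff d M => p.2 p.1 :=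
    measurable_uncurry_of_continuous_of_measurable (u := fun (y : M) (f : Diff d M) => f y)
      (fun f => f.continuous) measurable_eval
  exact h1.comp (((measurable_eval x).comp measurable_snd).prodMk measurable_fst)

end Measurability

end EuclideanEmbedding

/-! ### The volume growth cocycle. -/

section Growth

variable {d k : ℕ} {M : Type*} [TopologicalSpace M] [ChartedSpace (EuclideanSpace ℝ (Fin d)) M]

theorem TangentFrame.mk_congr {x : M} {v w : Fin k → TangentSpace (𝓡 d) x} (h : v = w)
    (hv : LinearIndependent ℝ v) (hw : LinearIndependent ℝ w) :
    (⟨x, v, hv⟩ : TangentFrame d k M) = ⟨x, w, hw⟩ := by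
  subst h; rfl

/-- Two frames spanning the same plane have proportional wedges. -/
theorem TangentFrame.exists_smul_of_toGrassmann_eq {e e' : TangentFrame d k M}
    (h : e.toGrassmann = e'.toGrassmann) :
    ∃ (c : ℝ) (hb : e'.base = e.base), exteriorPower.ιMulti ℝ k e'.vec =
      c • exteriorPower.ιMulti ℝ k (fun i => (hb ▸ e.vec i : TangentSpace (𝓡 d) e'.base)) := by
  obtain ⟨x, v, hv⟩ := e
  obtain ⟨y, v', hv'⟩ := e'
  obtain rfl : x = y := congrArg GrassmannBundle.base h
  simp only [toGrassmann, GrassmannBundle.mk.injEq, true_and] at h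
  obtain ⟨c, hc⟩ := exists_ιMulti_eq_smul hv h.ge
  exact ⟨c, rfl, hc⟩

/-- A frame of a given plane. -/
noncomputable def GrassmannBundle.frame (ξ : GrassmannBundle d k M) : TangentFrame d k M :=
  Function.surjInv toGrassmann_surjective ξ

theorem GrassmannBundle.toGrassmann_frame (ξ : GrassmannBundle d k M) :
    ξ.frame.toGrassmann = ξ := Function.surjInv_eq _ ξ

variable [IsManifold (𝓡 d) ∞ M]

theorem frameMap_trans (f g : Diff d M) (e : TangentFrame d k M) :
    frameMap (f.trans g) e = frameMap g (frameMap f e) := by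
  have := mfderiv_comp e.base (g.contMDiff.mdifferentiableAt (x := f e.base) (by simp))
    (f.contMDiff.mdifferentiableAt (x := e.base) (by simp))
  have h2 : ∀ i, mfderiv (𝓡 d) (𝓡 d) (f.trans g) e.base (e.vec i) =
      mfderiv (𝓡 d) (𝓡 d) g (f e.base) (mfderiv (𝓡 d) (𝓡 d) f e.base (e.vec i)) := fun i =>
    congrArg (fun L => L (e.vec i)) this
  exact TangentFrame.mk_congr (funext h2) _ _

theorem grassmannMap_trans (f g : Diff d M) (ξ : GrassmannBundle d k M) :
    grassmannMap (f.trans g) ξ = grassmannMap g (grassmannMap f ξ) := by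
  rw [← ξ.toGrassmann_frame]
  simp only [grassmannMap_toGrassmann, frameMap_trans]

theorem frameMap_refl (e : TangentFrame d k M) :
    frameMap (Diffeomorph.refl (𝓡 d) M ∞) e = e := by
  have h2 : ∀ i, mfderiv (𝓡 d) (𝓡 d) (Diffeomorph.refl (𝓡 d) M ∞) e.base (e.vec i) =
      e.vec i := fun i => congrArg (fun L => L (e.vec i)) (mfderiv_id (x := e.base))
  obtain ⟨x, v, hv⟩ := e
  exact TangentFrame.mk_congr (funext h2) _ _

theorem grassmannMap_refl (ξ : GrassmannBundle d k M) :
    grassmannMap (Diffeomorph.refl (𝓡 d) M ∞) ξ = ξ := by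
  conv_lhs => rw [← ξ.toGrassmann_frame, grassmannMap_toGrassmann, frameMap_refl,
    ξ.toGrassmann_frame]

variable [RiemannianBundle (fun x : M => TangentSpace (𝓡 d) x)]

/-- The Riemannian volume of a frame. -/
noncomputable def frameVol (e : TangentFrame d k M) : ℝ := ‖exteriorPower.ιMulti ℝ k e.vec‖

omit [IsManifold (𝓡 d) ∞ M] in
theorem frameVol_pos (e : TangentFrame d k M) : 0 < frameVol e :=
  norm_ιMulti_pos e.linearIndependent

/-- The Euclidean volume of the image of a frame. -/
noncomputable def euclidVol {n : ℕ} (h : M → EuclideanSpace ℝ (Fin n)) (e : TangentFrame d k M) :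
    ℝ := ‖exteriorPower.ιMulti ℝ k (euclidFrame h e)‖

theorem frameVol_frameMap (f : Diff d M) (e : TangentFrame d k M) :
    frameVol (frameMap f e) = ‖extPowDeriv k f e.base (exteriorPower.ιMulti ℝ k e.vec)‖ := by
  rw [frameVol, extPowDeriv, exteriorPower.map_apply_ιMulti]
  rfl

omit [IsManifold (𝓡 d) ∞ M] [RiemannianBundle (fun x : M => TangentSpace (𝓡 d) x)] in
theorem euclidVol_eq {n : ℕ} (h : M → EuclideanSpace ℝ (Fin n)) (e : TangentFrame d k M) :
    euclidVol h e =
      ‖exteriorPower.map k (euclidDeriv h e.base) (exteriorPower.ιMulti ℝ k e.vec)‖ := by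
  rw [euclidVol, exteriorPower.map_apply_ιMulti]
  rfl

/-- Changing the frame of a plane rescales its wedge, hence all volumes by one factor. Volume ratios
such as `growth` and `volRatio` therefore depend only on the plane. -/
theorem frameVol_proportional {e e' : TangentFrame d k M} (h : e.toGrassmann = e'.toGrassmann) :
    ∃ c : ℝ, 0 < c ∧ frameVol e' = c * frameVol e ∧
      (∀ f : Diff d M, frameVol (frameMap f e') = c * frameVol (frameMap f e)) ∧
      ∀ (n : ℕ) (g : M → EuclideanSpace ℝ (Fin n)), euclidVol g e' = c * euclidVol g e := by
  obtain ⟨c, hb, hc⟩ := e.exists_smul_of_toGrassmann_eq h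
  obtain ⟨x, v, hv⟩ := e
  obtain ⟨y, v', hv'⟩ := e'
  obtain rfl : y = x := hb
  have h1 : frameVol ⟨y, v', hv'⟩ = |c| * frameVol ⟨y, v, hv⟩ := by
    rw [frameVol, hc, norm_smul]; rfl
  refine ⟨|c|, ?_, h1, fun f => ?_, fun n g => ?_⟩
  · refine (abs_nonneg c).lt_of_ne' fun h0 => ?_
    have := frameVol_pos (⟨y, v', hv'⟩ : TangentFrame d k M)
    rw [h1, h0, zero_mul] at this
    exact this.false
  · rw [frameVol_frameMap, frameVol_frameMap, hc, map_smul, norm_smul]; rfl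
  · rw [euclidVol_eq, euclidVol_eq, hc, map_smul, norm_smul]; rfl

/-- The logarithmic growth of the volume of a plane under a diffeomorphism. -/
noncomputable def growth (f : Diff d M) (ξ : GrassmannBundle d k M) : ℝ :=
  Real.log (frameVol (frameMap f ξ.frame) / frameVol ξ.frame)

theorem growth_toGrassmann (f : Diff d M) (e : TangentFrame d k M) :
    growth f e.toGrassmann = Real.log (frameVol (frameMap f e) / frameVol e) := by
  obtain ⟨c, hc, h1, h2, -⟩ := frameVol_proportional e.toGrassmann.toGrassmann_frame
  rw [growth, h1, h2, mul_div_mul_left _ _ hc.ne']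

/-- The ratio of the Riemannian volume and a Euclidean one. -/
noncomputable def volRatio {n : ℕ} (h : M → EuclideanSpace ℝ (Fin n)) (ξ : GrassmannBundle d k M) :
    ℝ := frameVol ξ.frame / euclidVol h ξ.frame

theorem volRatio_toGrassmann {n : ℕ} (h : M → EuclideanSpace ℝ (Fin n)) (e : TangentFrame d k M) :
    volRatio h e.toGrassmann = frameVol e / euclidVol h e := by
  obtain ⟨c, hc, h1, -, h2⟩ := frameVol_proportional e.toGrassmann.toGrassmann_frame
  rw [volRatio, h1, h2, mul_div_mul_left _ _ hc.ne']

/-- The additive cocycle identity, from the chain rule; all later sums along orbits rest on it. -/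
theorem growth_trans (f g : Diff d M) (ξ : GrassmannBundle d k M) :
    growth (f.trans g) ξ = growth g (grassmannMap f ξ) + growth f ξ := by
  rw [← ξ.toGrassmann_frame]
  simp only [grassmannMap_toGrassmann, growth_toGrassmann, frameMap_trans]
  have h1 := frameVol_pos ξ.frame
  have h2 := frameVol_pos (frameMap f ξ.frame)
  have h3 := frameVol_pos (frameMap g (frameMap f ξ.frame))
  rw [← Real.log_mul (by positivity) (by positivity)]
  congr 1
  field_simp

theorem growth_refl (ξ : GrassmannBundle d k M) :
    growth (Diffeomorph.refl (𝓡 d) M ∞) ξ = 0 := by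
  rw [growth, frameMap_refl, div_self (frameVol_pos _).ne', Real.log_one]

theorem log_norm_extPowDeriv_frame (f : Diff d M) (e : TangentFrame d k M) :
    Real.log ‖extPowDeriv k f e.base (exteriorPower.ιMulti ℝ k e.vec)‖ =
      growth f e.toGrassmann + Real.log (frameVol e) := by
  rw [growth_toGrassmann, Real.log_div (frameVol_pos _).ne' (frameVol_pos _).ne', frameVol_frameMap]
  ring

theorem log_norm_extPowDeriv (f : Diff d M) (ξ : GrassmannBundle d k M)
    {w : ⋀[ℝ]^k (TangentSpace (𝓡 d) ξ.base)} (hw : PluckerRepresents ξ w) :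
    Real.log ‖extPowDeriv k f ξ.base w‖ = growth f ξ + Real.log ‖w‖ := by
  obtain ⟨v, hv, hspan, rfl⟩ := hw
  obtain ⟨x, V, hV⟩ := ξ
  have : (⟨x, v, hv⟩ : TangentFrame d k M).toGrassmann = ⟨x, V, hV⟩ :=
    GrassmannBundle.mk_congr hspan _ _
  rw [← this]
  exact log_norm_extPowDeriv_frame f ⟨x, v, hv⟩

section Continuity

variable [IsContMDiffRiemannianBundle (𝓡 d) ∞ (EuclideanSpace ℝ (Fin d))
      (fun x : M => TangentSpace (𝓡 d) x)]

theorem continuous_frameVol : Continuous (frameVol : TangentFrame d k M → ℝ) := by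
  have : IsContinuousRiemannianBundle (EuclideanSpace ℝ (Fin d))
      (fun x : M => TangentSpace (𝓡 d) x) := by
    obtain ⟨g, hg, hg'⟩ := IsContMDiffRiemannianBundle.exists_contMDiff (IB := 𝓡 d) (n := ∞)
      (F := EuclideanSpace ℝ (Fin d)) (E := fun x : M => TangentSpace (𝓡 d) x)
    exact ⟨g, hg.continuous, hg'⟩
  have h1 : (frameVol : TangentFrame d k M → ℝ) = fun e => √(Matrix.gram ℝ e.vec).det :=
    funext fun e => norm_ιMulti e.vec
  rw [h1]
  refine Real.continuous_sqrt.comp (Continuous.matrix_det (continuous_matrix fun i j => ?_))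
  exact (continuous_frame_vec i).inner_bundle (continuous_frame_vec j)

theorem continuous_growth (f : Diff d M) :
    Continuous (growth f : GrassmannBundle d k M → ℝ) := by
  refine continuous_grassmann_iff.2 ?_
  simp only [growth_toGrassmann]
  refine Continuous.log ?_ fun e => (div_pos (frameVol_pos _) (frameVol_pos _)).ne'
  exact (continuous_frameVol.comp (continuous_frameMap f)).div continuous_frameVol
    fun e => (frameVol_pos e).ne'

variable [CompactSpace M] [T2Space M] [MeasurableSpace M] [BorelSpace M]

/-- Factor the Riemannian volume of the image frame as a continuous function of its plane times its
Euclidean volume. The latter is measurable by difference quotients. -/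
theorem measurable_growth_left (ξ : GrassmannBundle d k M) :
    Measurable fun f : Diff d M => growth f ξ := by
  obtain ⟨n, h, hh, -, hinj⟩ := exists_embedding_euclidean_of_compact (I := 𝓡 d) (M := M)
  obtain ⟨e, rfl⟩ := GrassmannBundle.toGrassmann_surjective ξ
  have hpos : ∀ e : TangentFrame d k M, 0 < euclidVol h e := fun e =>
    norm_ιMulti_pos (linearIndependent_euclidFrame hinj e)
  have hc : Continuous (volRatio h : GrassmannBundle d k M → ℝ) := by
    refine continuous_grassmann_iff.2 ?_
    simp only [volRatio_toGrassmann]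
    exact continuous_frameVol.div (continuous_norm_ιMulti.comp (continuous_euclidFrame hh))
      fun e => (hpos e).ne'
  have heq : (fun f : Diff d M => growth f e.toGrassmann) = fun f =>
      Real.log (volRatio h (grassmannMap f e.toGrassmann) * euclidVol h (frameMap f e) /
        frameVol e) := by
    funext f
    rw [growth_toGrassmann, grassmannMap_toGrassmann, volRatio_toGrassmann,
      div_mul_cancel₀ _ (hpos _).ne']
  rw [heq]
  refine Real.measurable_log.comp (Measurable.div_const (Measurable.mul ?_ ?_) _)
  · exact hc.measurable.comp (measurable_grassmannMap_left _)
  · exact continuous_norm_ιMulti.measurable.comp (measurable_euclidFrame hh e)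

theorem measurable_growth :
    Measurable fun p : Diff d M × GrassmannBundle d k M => growth p.1 p.2 := by
  have := metrizableSpace_grassmannBundle d k M
  have := secondCountable_grassmannBundle d k M
  have h : Measurable (Function.uncurry
      fun (ξ : GrassmannBundle d k M) (f : Diff d M) => growth f ξ) :=
    measurable_uncurry_of_continuous_of_measurable
      (fun f => continuous_growth f) (fun ξ => measurable_growth_left ξ)
  have e : (fun p : Diff d M × GrassmannBundle d k M => growth p.1 p.2) = (Function.uncurry
      fun (ξ : GrassmannBundle d k M) (f : Diff d M) => growth f ξ) ∘ Prod.swap := by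
    funext p; rfl
  rw [e]
  exact Measurable.comp h measurable_swap

end Continuity

omit [IsManifold (𝓡 d) ∞ M] in
/-- Every plane has an orthonormal frame. -/
theorem GrassmannBundle.exists_orthonormal_frame (ξ : GrassmannBundle d k M) :
    ∃ e : TangentFrame d k M, e.toGrassmann = ξ ∧ Orthonormal ℝ e.vec := by
  obtain ⟨x, V, hV⟩ := ξ
  let W : Submodule ℝ (TangentSpace (𝓡 d) x) := V
  let b := (stdOrthonormalBasis ℝ W).reindex (finCongr hV)
  have hb : Orthonormal ℝ fun i => (b i : TangentSpace (𝓡 d) x) :=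
    b.orthonormal.comp_linearIsometry W.subtypeₗᵢ
  refine ⟨⟨x, _, hb.linearIndependent⟩, GrassmannBundle.mk_congr ?_ _ _, hb⟩
  have h := congrArg (Submodule.map W.subtype) b.toBasis.span_eq
  rw [Submodule.map_span, Submodule.map_top, Submodule.range_subtype, ← Set.range_comp] at h
  convert h using 2
  ext i; simp [Function.comp_def]

/-- The growth under a volume preserving diffeomorphism is controlled by the norm of the
derivative. -/
theorem abs_growth_le {f : Diff d M} (hf : IsVolumePreserving f) {C : ℝ} (hC1 : 1 ≤ C)
    (hC : ∀ (x : M) (v : TangentSpace (𝓡 d) x), ‖mfderiv (𝓡 d) (𝓡 d) f x v‖ ≤ C * ‖v‖)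
    (hk : k ≤ d) (ξ : GrassmannBundle d k M) : |growth f ξ| ≤ d * Real.log C := by
  obtain ⟨e, rfl, he⟩ := ξ.exists_orthonormal_frame
  have h1 : frameVol e = 1 := norm_ιMulti_of_orthonormal he
  have hpos := frameVol_pos (frameMap f e)
  rw [growth_toGrassmann, h1, div_one]
  have hupper : frameVol (frameMap f e) ≤ C ^ k :=
    norm_ιMulti_le_pow _ fun i => (hC _ _).trans (by rw [he.1 i, mul_one])
  -- The `d - k` complementary directions carry volume at most `C ^ (d - k)`, so a preserved total
  -- volume bounds the `k`-volume from below.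
  have hlower : 1 ≤ C ^ (d - k) * frameVol (frameMap f e) :=
    one_le_pow_mul_norm_ιMulti (mfderiv (𝓡 d) (𝓡 d) f e.base).toLinearMap (hC e.base)
      (finrank_euclideanSpace_fin (𝕜 := ℝ) (n := d)) (by linarith) (hf e.base) (d - k) (by omega) he
  have hl : 0 ≤ Real.log C := Real.log_nonneg hC1
  have hu := Real.log_le_log hpos hupper
  have hlo := Real.log_le_log one_pos hlower
  rw [Real.log_pow] at hu
  rw [Real.log_one, Real.log_mul (by positivity) hpos.ne', Real.log_pow] at hlo
  have k1 : (k : ℝ) ≤ d := by exact_mod_cast hk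
  have k2 : ((d - k : ℕ) : ℝ) ≤ d := by exact_mod_cast Nat.sub_le d k
  rw [abs_le]
  constructor <;> nlinarith

end Growth

theorem iterate_skew {d k : ℕ} {M : Type*} [TopologicalSpace M]
    [ChartedSpace (EuclideanSpace ℝ (Fin d)) M] [IsManifold (𝓡 d) ∞ M]
    (p : (ℕ → Diff d M) × GrassmannBundle d k M) (n : ℕ) :
    (skew grassmannMap)^[n] p = (fun i => p.1 (i + n), grassmannMap (iterate p.1 n) p.2) := by
  induction n with
  | zero => exact Prod.ext rfl (grassmannMap_refl p.2).symm
  | succ n ih =>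
    rw [Function.iterate_succ_apply', ih, iterate, grassmannMap_trans]
    refine Prod.ext (funext fun i => ?_) ?_
    · exact congrArg p.1 (by omega)
    · exact congrArg (fun j => grassmannMap (p.1 j) (grassmannMap (iterate p.1 n) p.2)) (zero_add n)

theorem exists_growth_bound {d k : ℕ} {M : Type*} [TopologicalSpace M]
    [ChartedSpace (EuclideanSpace ℝ (Fin d)) M] [IsManifold (𝓡 d) ∞ M] [MeasurableSpace M]
    [RiemannianBundle (fun x : M => TangentSpace (𝓡 d) x)] {μ : Measure (Diff d M)}
    (hvol : ∀ᵐ f : Diff d M ∂μ, IsVolumePreserving f)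
    (hbdd : HasBoundedSupport μ) (hk : k ≤ d) :
    ∃ B : ℝ, ∀ᵐ f ∂μ, ∀ ξ : GrassmannBundle d k M, |growth f ξ| ≤ B := by
  obtain ⟨C, hC⟩ := hbdd
  -- Taking the maximum with `1` supplies the hypothesis `1 ≤ C` of `abs_growth_le`.
  refine ⟨d * Real.log (max C 1), ?_⟩
  filter_upwards [hvol, hC] with f hf hfC ξ
  refine abs_growth_le hf (le_max_right _ _) (fun x v => (hfC x v).trans ?_) hk ξ
  gcongr
  exact le_max_left _ _

/-! ### The random walk on the Grassmann bundle. -/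

section Walk

variable {d k : ℕ} {M : Type*} [TopologicalSpace M] [ChartedSpace (EuclideanSpace ℝ (Fin d)) M]
  [IsManifold (𝓡 d) ∞ M] [CompactSpace M] [T2Space M] [MeasurableSpace M] [BorelSpace M]
  {μ : Measure (Diff d M)} [IsProbabilityMeasure μ]

theorem isProbabilityMeasure_convPow (n : ℕ) : IsProbabilityMeasure (convPow μ n) := by
  induction n with
  | zero => exact Measure.dirac.isProbabilityMeasure
  | succ n ih => exact Measure.isProbabilityMeasure_map measurable_trans.aemeasurable

/-- `convPow` composes the new diffeomorphism on the outside, which is the order in which `lawAt`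
advances the walk. -/
theorem map_grassmannMap_convPow (ξ : GrassmannBundle d k M) (n : ℕ) :
    (convPow μ n).map (fun f => grassmannMap f ξ) = lawAt μ grassmannMap ξ n := by
  induction n with
  | zero =>
    rw [convPow, lawAt, Measure.map_dirac' (measurable_grassmannMap_left ξ), grassmannMap_refl]
  | succ n ih =>
    have := isProbabilityMeasure_convPow (μ := μ) n
    have hid : Measurable (Function.uncurry (grassmannMap (d := d) (k := k) (M := M))) :=
      measurable_grassmannMap
    have hp : (μ.prod (convPow μ n)).map (Prod.map id fun f => grassmannMap f ξ) =
        μ.prod (lawAt μ grassmannMap ξ n) := by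
      rw [← ih, ← Measure.map_prod_map μ (convPow μ n) measurable_id
        (measurable_grassmannMap_left ξ), Measure.map_id]
    rw [convPow, lawAt, ← hp, Measure.map_map (measurable_grassmannMap_left ξ) measurable_trans,
      Measure.map_map hid (measurable_id.prodMap (measurable_grassmannMap_left ξ))]
    congr 1
    funext p
    exact grassmannMap_trans p.2 p.1 ξ

variable [RiemannianBundle (fun x : M => TangentSpace (𝓡 d) x)]

omit [CompactSpace M] [T2Space M] [MeasurableSpace M] [BorelSpace M] in
theorem birkhoffSum_growth (p : (ℕ → Diff d M) × GrassmannBundle d k M) (n : ℕ) :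
    birkhoffSum (skew grassmannMap) (fun p => growth (p.1 0) p.2) n p =
      growth (iterate p.1 n) p.2 := by
  induction n with
  | zero => simp [iterate, growth_refl]
  | succ n ih =>
    rw [birkhoffSum_succ, ih, iterate_skew, iterate, growth_trans, add_comm]
    simp only [zero_add]

variable [IsContMDiffRiemannianBundle (𝓡 d) ∞ (EuclideanSpace ℝ (Fin d))
      (fun x : M => TangentSpace (𝓡 d) x)]

/-- By the cocycle identity each new step adds the drift averaged over the current law.
Integrability is carried along in the induction because splitting the integral needs it at every
stage. -/
theorem integral_growth_convPow {B : ℝ}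
    (hB : ∀ᵐ f ∂μ, ∀ ξ : GrassmannBundle d k M, |growth f ξ| ≤ B)
    (ξ : GrassmannBundle d k M) (n : ℕ) :
    Integrable (fun f => growth f ξ) (convPow μ n) ∧
    ∫ f, growth f ξ ∂(convPow μ n) =
      ∑ i ∈ Finset.range n, ∫ z, ∫ f, growth f z ∂μ ∂(lawAt μ grassmannMap ξ i) := by
  have := metrizableSpace_grassmannBundle d k M
  have := compactSpace_grassmannBundle (d := d) (k := k) (M := M)
  have hgm : Measurable (Function.uncurry (growth (d := d) (k := k) (M := M))) := measurable_growth
  induction n with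
  | zero =>
    have hm := measurable_growth_left ξ
    refine ⟨?_, ?_⟩
    · rw [convPow]
      exact (integrable_dirac' hm.stronglyMeasurable (by simp))
    · rw [convPow, integral_dirac' _ _ hm.stronglyMeasurable, growth_refl, Finset.sum_range_zero]
  | succ n ih =>
    have := isProbabilityMeasure_convPow (μ := μ) n
    have hm := measurable_growth_left ξ
    have hF := measurable_grassmannMap_left ξ
    set q : Diff d M × Diff d M → ℝ := fun p => growth p.1 (grassmannMap p.2 ξ) with hq
    have hqm : Measurable q := by
      have e : q = Function.uncurry (growth (d := d) (k := k) (M := M)) ∘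
        fun p : Diff d M × Diff d M => (p.1, grassmannMap p.2 ξ) := rfl
      rw [e]
      exact Measurable.comp hgm (measurable_fst.prodMk (hF.comp measurable_snd))
    have hqi : Integrable q (μ.prod (convPow μ n)) := by
      refine Integrable.of_bound hqm.aestronglyMeasurable B ?_
      have : ∀ᵐ p ∂(μ.prod (convPow μ n)), ∀ ξ : GrassmannBundle d k M, |growth p.1 ξ| ≤ B :=
        Measure.quasiMeasurePreserving_fst.ae hB
      filter_upwards [this] with p hp using hp _
    have hri : Integrable (fun p : Diff d M × Diff d M => growth p.2 ξ) (μ.prod (convPow μ n)) :=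
      ih.1.comp_snd μ
    have hcomp : (fun p : Diff d M × Diff d M => growth (p.2.trans p.1) ξ) =
        fun p => q p + growth p.2 ξ := funext fun p => growth_trans p.2 p.1 ξ
    rw [convPow]
    constructor
    · refine (integrable_map_measure hm.aestronglyMeasurable measurable_trans.aemeasurable).2 ?_
      change Integrable (fun p : Diff d M × Diff d M => growth (p.2.trans p.1) ξ) _
      rw [hcomp]
      exact hqi.add hri
    · rw [integral_map measurable_trans.aemeasurable hm.aestronglyMeasurable, hcomp,
        integral_add hqi hri, Finset.sum_range_succ, ← ih.2, add_comm, integral_prod_symm _ hqi,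
        ← map_grassmannMap_convPow]
      congr 1
      · rw [integral_prod_symm _ hri]; simp
      · have hc := continuous_integral_param (μ := μ) hgm (fun f => continuous_growth f) hB
        rw [integral_map hF.aemeasurable hc.measurable.aestronglyMeasurable]

end Walk

end RandomWalk

/-! ### The main theorem. -/

open RandomWalk in
theorem mainTheorem4 (d : ℕ) (M : Type*) [TopologicalSpace M]
    [ChartedSpace (EuclideanSpace ℝ (Fin d)) M] [IsManifold (𝓡 d) ∞ M]
    [CompactSpace M] [T2Space M] [MeasurableSpace M] [BorelSpace M]
    [RiemannianBundle (fun x : M => TangentSpace (𝓡 d) x)]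
    [IsContMDiffRiemannianBundle (𝓡 d) ∞ (EuclideanSpace ℝ (Fin d))
      (fun x : M => TangentSpace (𝓡 d) x)]
    (μ : Measure (Diff d M)) [IsProbabilityMeasure μ]
    (hvol : ∀ᵐ f : Diff d M ∂μ, IsVolumePreserving f) (hbdd : HasBoundedSupport μ)
    (hμ : ¬ UniformlyExpandingInAllDims μ) :
    ∃ k : ℕ, 1 ≤ k ∧ k < d ∧ ∃ η : Measure (GrassmannBundle d k M),
      IsProbabilityMeasure η ∧ IsStationary μ η ∧ IsErgodic μ η ∧
      ∃ χ : ℝ, χ ≤ 0 ∧ HasLyapunovExponent μ η χ := by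

  obtain ⟨k, hk1, hkd, hk⟩ : ∃ k : ℕ, 1 ≤ k ∧ k < d ∧ ¬ UniformlyExpandingInDim k μ := by
    simpa [UniformlyExpandingInAllDims] using hμ
  refine ⟨k, hk1, hkd, ?_⟩
  obtain ⟨B, hB⟩ := exists_growth_bound (k := k) hvol hbdd hkd.le
  have := metrizableSpace_grassmannBundle d k M
  have := compactSpace_grassmannBundle (d := d) (k := k) (M := M)
  have hgm : Measurable (Function.uncurry (growth (d := d) (k := k) (M := M))) := measurable_growth
  have hFm : Measurable (Function.uncurry (grassmannMap (d := d) (k := k) (M := M))) :=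
    measurable_grassmannMap
  have hN : ∀ N : ℕ, ∃ ξ : GrassmannBundle d k M,
      ∑ i ∈ Finset.range N, ∫ z, ∫ f, growth f z ∂μ ∂(lawAt μ grassmannMap ξ i) ≤ 1 := by
    intro N
    simp only [UniformlyExpandingInDim, not_exists, not_and, not_forall, not_lt] at hk
    -- Any constant independent of `N` would serve in place of `1`, since time averaging divides it
    -- by `N`.
    obtain ⟨x, _, ⟨v, rfl⟩, hw, hle⟩ := hk 1 one_pos N
    have hv : LinearIndependent ℝ v := by
      by_contra hv
      rw [AlternatingMap.map_linearDependent _ _ hv, norm_zero] at hw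
      exact zero_ne_one hw
    let e : TangentFrame d k M := ⟨x, v, hv⟩
    refine ⟨e.toGrassmann, ?_⟩
    rw [← (integral_growth_convPow hB e.toGrassmann N).2]
    refine le_trans (le_of_eq (integral_congr_ae (.of_forall fun f => ?_))) hle
    have h1 := log_norm_extPowDeriv_frame f e
    have h2 : frameVol e = 1 := hw
    rw [h2, Real.log_one, add_zero] at h1
    exact h1.symm
  obtain ⟨η, hη, hst, herg, χ, hχ, hlim⟩ := exists_ergodic_stationary_tendsto_nonpos (μ := μ) hFm
    (fun f => continuous_grassmannMap f) hgm (fun f => continuous_growth f) hB hN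
  refine ⟨η, hη, hst, herg, χ, hχ, ?_⟩
  filter_upwards [hlim] with p hp w hw
  -- The choice of `w` representing the plane shifts the logarithm by a constant, which disappears
  -- after division by `n`.
  have h0 : Tendsto (fun n : ℕ => (1 / (n : ℝ)) * Real.log ‖w‖) atTop (𝓝 0) := by
    simpa using (tendsto_one_div_atTop_nhds_zero_nat (𝕜 := ℝ)).mul_const (Real.log ‖w‖)
  have h1 := hp.add h0
  rw [add_zero] at h1
  refine h1.congr fun n => ?_
  rw [log_norm_extPowDeriv _ _ hw, birkhoffSum_growth, mul_add]
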